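/- All $\mathbb Z$-lattices below are full $\mathbb Z$-lattices $L$ on three-dimensional positive definite quadratic spaces $(V,Q)$ over $\mathbb Q$ that are (non-classic) integral, that is, $Q(L)\subseteq\mathbb Z$. The genus $\mathrm{gen}(L)$ is the set of lattices $L'$ on $V$ such that for every prime $p$ there is an isometry $\sigma_p\in O(V_p)$ with $L'_p=\sigma_pL_p$. The spinor genus $\mathrm{spn}(L)$ is the set of lattices $L'$ on $V$ for which there are $\sigma\in O(V)$ and, for every prime $p$, some $\Sigma_p\in O'(V_p)$ with $L'_p=\sigma_p\Sigma_pL_p$, where $O'(V_p)$ is the kernel of the spinor norm on the rotation group $O^+(V_p)$. Let $\mathrm{gen}(L)_S=\{\mathrm{spn}(L'):L'\in\mathrm{gen}(L)\}$ and let $g(L)=|\mathrm{gen}(L)_S|$, the number of spinor genera in $\mathrm{gen}(L)$. For a positive integer $n$, $L^n$ is $L$ with its quadratic form multiplied by $n$. **Lemma 4.3.** Let $n$ be a positive integer, and let $N$ and $M$ be ternary $\mathbb Z$-lattices such that $([N],[M])$ is a representable pair by scaling $n$, that is, there is a representation $\phi:M^n\to N$ with $[N:\phi(M^n)]=n$.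 Let $\mathfrak G(N,M)$ be the bipartite graph with vertex classes $\mathrm{gen}(N)_S$ and $\mathrm{gen}(M)_S$ in which $\mathrm{spn}(N')$ and $\mathrm{spn}(M')$ are joined by an edge if and only if there are $N''\in\mathrm{spn}(N')$ and $M''\in\mathrm{spn}(M')$ such that $(M'')^n$ is represented by $N''$. Then $g(N)$ and $g(M)$ are finite, and there are positive integers $u,v$ with $u\,g(N)=v\,g(M)$ such that $\mathfrak G(N,M)$ is $(u,v)$-regular: every vertex in $\mathrm{gen}(N)_S$ has exactly $u$ neighbours and every vertex in $\mathrm{gen}(M)_S$ has exactly $v$ neighbours. In particular, if $g(N)=g(M)$, then $\mathfrak G(N,M)$ is a regular bipartite graph: all its vertices have the same positive number of neighbours. -/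

import Mathlib

open scoped TensorProduct

noncomputable section

namespace QuadLattice

section Field

variable {K V : Type*} [Field K] [AddCommGroup V] [Module K V]

/-- The symmetry (reflection) `x ↦ x - (2 B(x, v) / Q(v)) v` in an anisotropic vector `v`. Here
`Q(x) = B(x, x)`, so that `2 B(x, v) = Q (x + v) - Q x - Q v` is the polar form. -/
def symmetry (Q : QuadraticForm K V) (v : {v : V // Q v ≠ 0}) : V ≃ₗ[K] V :=
  Module.reflection (x := v.1) (f := (Q v.1)⁻¹ • QuadraticMap.polarBilin Q v.1) (by
    have h := v.2
    simp only [LinearMap.smul_apply, QuadraticMap.polarBilin_apply_apply,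
      QuadraticMap.polar_self, smul_eq_mul]
    rw [two_nsmul, ← two_mul]
    field_simp)

/-- The group `O'(V)`: the kernel of the spinor norm `θ : O⁺(V) → Kˣ / (Kˣ)²`, given by
`θ(τ_{v₁} ⋯ τ_{vₖ}) = Q(v₁) ⋯ Q(vₖ) (Kˣ)²` for a product of an even number of symmetries.
(On a nondegenerate space over a field of characteristic not `2`, every rotation is such a
product, and `θ` does not depend on the factorization.) -/
def spinorKernel (Q : QuadraticForm K V) : Set (V ≃ₗ[K] V) :=
  {σ | ∃ l : List {v : V // Q v ≠ 0}, Even l.length ∧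
    σ = (l.map (symmetry Q)).prod ∧ IsSquare (l.map fun v => Q v.1).prod}

end Field

section Rational

variable {V : Type*} [AddCommGroup V] [Module ℚ V]

/-- The localization `L_p = ℤ_p L` of `L`, inside `V_p = ℚ_p ⊗ V`. -/
def localization (p : ℕ) [Fact p.Prime] (L : Submodule ℤ V) :
    Submodule ℤ_[p] (ℚ_[p] ⊗[ℚ] V) :=
  Submodule.span ℤ_[p] ((fun x : V => (1 : ℚ_[p]) ⊗ₜ[ℚ] x) '' (L : Set V))

/-- The quadratic form of the local quadratic space `V_p = ℚ_p ⊗ V`. -/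
def localForm (p : ℕ) [Fact p.Prime] (Q : QuadraticForm ℚ V) :
    QuadraticForm ℚ_[p] (ℚ_[p] ⊗[ℚ] V) :=
  Q.baseChange ℚ_[p]

/-- The extension `σ_p` of a linear automorphism `σ` of `V` to `V_p`. -/
def localMap (p : ℕ) [Fact p.Prime] (σ : V ≃ₗ[ℚ] V) :
    (ℚ_[p] ⊗[ℚ] V) ≃ₗ[ℚ_[p]] (ℚ_[p] ⊗[ℚ] V) :=
  LinearEquiv.baseChange ℚ ℚ_[p] V V σ

/-- The image `τ L` of a `ℤ_p`-lattice `L` in `V_p` under a linear automorphism `τ` of `V_p`. -/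
def localImage (p : ℕ) [Fact p.Prime]
    (τ : (ℚ_[p] ⊗[ℚ] V) ≃ₗ[ℚ_[p]] (ℚ_[p] ⊗[ℚ] V))
    (L : Submodule ℤ_[p] (ℚ_[p] ⊗[ℚ] V)) : Submodule ℤ_[p] (ℚ_[p] ⊗[ℚ] V) :=
  L.map (τ.toLinearMap.restrictScalars ℤ_[p])

/-- `L` is a (full, non-classic integral) `ℤ`-lattice on the quadratic space `(V, Q)`: it is
finitely generated, spans `V`, and `Q` takes integral values on `L`. -/
structure IsIntegralLattice (Q : QuadraticForm ℚ V) (L : Submodule ℤ V) : Prop where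
  isLattice : L.IsLattice ℚ
  integral : ∀ x ∈ L, ∃ k : ℤ, Q x = k

/-- The genus of `L`: the lattices `L'` on `V` such that for every prime `p` there is an isometry
`σ` of `V_p` with `L'_p = σ L_p`. -/
def gen (Q : QuadraticForm ℚ V) (L : Submodule ℤ V) : Set (Submodule ℤ V) :=
  {L' | L'.IsLattice ℚ ∧ ∀ (p : ℕ) [Fact p.Prime],
    ∃ σ : (localForm p Q).IsometryEquiv (localForm p Q),
      localization p L' = localImage p σ.toLinearEquiv (localization p L)}

/-- The spinor genus of `L`: the lattices `L'` on `V` for which there are an isometry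
`σ ∈ O(V)` and, for every prime `p`, some `Σ_p ∈ O'(V_p)` such that `L'_p = σ_p Σ_p L_p`.

In odd dimension this is the same as the proper spinor genus, in which `σ` has to be a rotation,
because `-1` is an isometry of determinant `-1` that preserves every lattice. -/
def spn (Q : QuadraticForm ℚ V) (L : Submodule ℤ V) : Set (Submodule ℤ V) :=
  {L' | L'.IsLattice ℚ ∧ ∃ σ : Q.IsometryEquiv Q, ∀ (p : ℕ) [Fact p.Prime],
    ∃ τ ∈ spinorKernel (localForm p Q),
      localization p L' = localImage p (localMap p σ.toLinearEquiv)
        (localImage p τ (localization p L))}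

/-- The set `gen(L)_S` of all spinor genera in the genus of `L`. -/
def spinorGenera (Q : QuadraticForm ℚ V) (L : Submodule ℤ V) : Set (Set (Submodule ℤ V)) :=
  spn Q '' gen Q L

/-- The number `g(L)` of spinor genera in the genus of `L`. -/
def numSpinorGenera (Q : QuadraticForm ℚ V) (L : Submodule ℤ V) : ℕ :=
  (spinorGenera Q L).ncard

end Rational

section Pair

variable {W V : Type*} [AddCommGroup W] [Module ℚ W] [AddCommGroup V] [Module ℚ V]

/-- The image of `M` under a map of quadratic spaces `φ : V^n → W`, where `V^n` is `V` with the
quadratic form scaled by `n`. -/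
def scaledImage {n : ℕ} {R : QuadraticForm ℚ W} {Q : QuadraticForm ℚ V}
    (φ : ((n : ℚ) • Q) →qᵢ R) (M : Submodule ℤ V) : Submodule ℤ W :=
  M.map (φ.toLinearMap.restrictScalars ℤ)

/-- The standing assumption on lattices `N` on `(W, R)` and `M` on `(V, Q)`, in words
"`([N], [M])` is a representable pair by scaling `n`": there is a representation `φ : M^n → N`
such that `[N : φ(M^n)] = n`. -/
def IsRepresentablePair (n : ℕ) (R : QuadraticForm ℚ W) (Q : QuadraticForm ℚ V)
    (N : Submodule ℤ W) (M : Submodule ℤ V) : Prop :=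
  ∃ φ : ((n : ℚ) • Q) →qᵢ R, scaledImage φ M ≤ N ∧
    (scaledImage φ M).toAddSubgroup.relIndex N.toAddSubgroup = n

/-- `M^n` is represented by `N`. For lattices in the genera of `N` and `M`, where `([N], [M])` is
a representable pair by scaling `n`, this is the definition of a representable pair by scaling
`n`; the index of the image is automatically `n`, by comparison of discriminants. -/
def Represents (n : ℕ) (R : QuadraticForm ℚ W) (Q : QuadraticForm ℚ V)
    (N : Submodule ℤ W) (M : Submodule ℤ V) : Prop :=
  ∃ φ : ((n : ℚ) • Q) →qᵢ R, scaledImage φ M ≤ N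

/-- The bipartite graph `𝔊(N, M)`. Its vertices are the spinor genera in `gen(N)` (left) and in
`gen(M)` (right); a left vertex `x` and a right vertex `y` are adjacent if and only if there are
lattices `N'' ∈ x` and `M'' ∈ y` such that `(M'')^n` is represented by `N''`. -/
def spinorGraph (n : ℕ) (R : QuadraticForm ℚ W) (Q : QuadraticForm ℚ V)
    (N : Submodule ℤ W) (M : Submodule ℤ V) :
    SimpleGraph (spinorGenera R N ⊕ spinorGenera Q M) where
  Adj
    | .inl x, .inr y => ∃ N'' ∈ x.1, ∃ M'' ∈ y.1, Represents n R Q N'' M''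
    | .inr y, .inl x => ∃ N'' ∈ x.1, ∃ M'' ∈ y.1, Represents n R Q N'' M''
    | _, _ => False
  symm := ⟨by rintro (x | y) (x' | y') h <;> exact h⟩
  loopless := ⟨by rintro (x | y) h <;> exact h⟩

end Pair

/-- A bipartite graph with parts `A` (left) and `B` (right) is `(u, v)`-regular: every left vertex
has exactly `u` neighbours and every right vertex has exactly `v` neighbours. -/
def IsBiregular {A B : Type*} (G : SimpleGraph (A ⊕ B)) (u v : ℕ) : Prop :=
  (∀ a : A, (G.neighborSet (Sum.inl a)).encard = u) ∧
    ∀ b : B, (G.neighborSet (Sum.inr b)).encard = v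

end QuadLattice

end

open QuadLattice

open scoped TensorProduct

noncomputable section

/-! A group acts on the graph, transitively on each vertex class. Take families of local isometries
`σ p` of `V_p`, equal to `1` for almost all `p`. By the local-global description of lattices, such a
family sends a lattice `L` to the lattice with localizations `σ_p L_p`, and any two lattices in a
genus are related in this way.

The action descends to spinor genera because they are governed by an abelian quotient. Local
isometries are products of symmetries, and a commutator of two such products uses each vector twice,
so it is a product of an even number of symmetries with square spinor norm. Hence commutators lie in
`O'(V_p)`, which is also normal, and a family can be moved past the global isometry and the
`O'`-family linking two lattices of one spinor genus (`mem_spn_of_isLocalImage`).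

A representation of `M^n` in `N` gives a similarity `e : V ≃ W` with factor `n`; conjugation by `e`
identifies the isometries of `V_p` and `W_p`. Up to a global isometry, an edge is an inclusion of `e
M''` in `N''`, and inclusions survive a simultaneous local move. So the families act by injective
maps preserving adjacency (`exists_spinorGraph_map`). Transitivity makes degrees constant on each
class, the given representation is an edge, so degrees are positive, and counting edges twice gives
`u g(N) = v g(M)`.

Finiteness is classical reduction theory: each lattice in the genus has a basis whose Gram matrix is
integral and bounded by the Gram determinant, a genus invariant up to sign. So finitely many Gram
matrices, hence finitely many isometry classes, occur. -/

namespace QuadLattice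

/-! ### Symmetries, isometries and the kernel of the spinor norm -/

section Field

variable {K V : Type*} [Field K] [AddCommGroup V] [Module K V]

/-- The isometries of `(V, Q)`, as a subgroup of the linear automorphisms of `V`. -/
def isometryGroup (Q : QuadraticForm K V) : Subgroup (V ≃ₗ[K] V) where
  carrier := {σ | ∀ x, Q (σ x) = Q x}
  mul_mem' {σ τ} hσ hτ x := (hσ (τ x)).trans (hτ x)
  one_mem' _ := rfl
  inv_mem' {σ} hσ x := by
    have := hσ (σ⁻¹ x)
    rw [← LinearEquiv.mul_apply, mul_inv_cancel] at this
    exact this.symm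

theorem polar_map_of_mem {Q : QuadraticForm K V} {σ : V ≃ₗ[K] V} (hσ : σ ∈ isometryGroup Q)
    (x y : V) : QuadraticMap.polar Q (σ x) (σ y) = QuadraticMap.polar Q x y := by
  simp only [QuadraticMap.polar, ← map_add, hσ _]

theorem symmetry_apply (Q : QuadraticForm K V) (v : {v : V // Q v ≠ 0}) (x : V) :
    symmetry Q v x = x - ((Q v.1)⁻¹ * QuadraticMap.polar Q v.1 x) • v.1 := by
  rw [symmetry, Module.reflection_apply]
  simp

theorem symmetry_apply_of_polar_eq_zero {Q : QuadraticForm K V} {v : {v : V // Q v ≠ 0}} {x : V}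
    (h : QuadraticMap.polar Q v.1 x = 0) : symmetry Q v x = x := by
  simp [symmetry_apply, h]

theorem symmetry_mem (Q : QuadraticForm K V) (v : {v : V // Q v ≠ 0}) :
    symmetry Q v ∈ isometryGroup Q := by
  intro x
  have h := v.2
  rw [symmetry_apply, sub_eq_add_neg, QuadraticMap.map_add Q, QuadraticMap.map_neg,
    QuadraticMap.map_smul, QuadraticMap.polar_neg_right, QuadraticMap.polar_smul_right,
    QuadraticMap.polar_comm Q x]
  simp only [smul_eq_mul]
  field_simp
  ring

theorem conj_symmetry {Q : QuadraticForm K V} {σ : V ≃ₗ[K] V} (hσ : σ ∈ isometryGroup Q)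
    (v : {v : V // Q v ≠ 0}) :
    σ * symmetry Q v * σ⁻¹ = symmetry Q ⟨σ v.1, by rw [hσ]; exact v.2⟩ := by
  ext x
  obtain ⟨y, rfl⟩ := σ.surjective x
  have : σ⁻¹ (σ y) = y := σ.symm_apply_apply y
  simp only [LinearEquiv.mul_apply, this, symmetry_apply, map_sub, map_smul, hσ _,
    polar_map_of_mem hσ]

theorem prod_symmetry_mem (Q : QuadraticForm K V) (l : List {v : V // Q v ≠ 0}) :
    (l.map (symmetry Q)).prod ∈ isometryGroup Q :=
  Subgroup.list_prod_mem _ (by simp only [List.mem_map]; rintro _ ⟨v, -, rfl⟩; exact symmetry_mem Q v)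

theorem prod_symmetry_inv (Q : QuadraticForm K V) (l : List {v : V // Q v ≠ 0}) :
    ((l.map (symmetry Q)).prod)⁻¹ = (l.reverse.map (symmetry Q)).prod := by
  rw [List.prod_inv_reverse, List.map_map, ← List.map_reverse]
  congr 2

theorem one_mem_spinorKernel (Q : QuadraticForm K V) : 1 ∈ spinorKernel Q :=
  ⟨[], by simp, by simp, by simp⟩

theorem mul_mem_spinorKernel {Q : QuadraticForm K V} {σ τ : V ≃ₗ[K] V}
    (hσ : σ ∈ spinorKernel Q) (hτ : τ ∈ spinorKernel Q) : σ * τ ∈ spinorKernel Q := by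
  obtain ⟨l, hl, rfl, hl'⟩ := hσ
  obtain ⟨m, hm, rfl, hm'⟩ := hτ
  refine ⟨l ++ m, ?_, by simp, ?_⟩
  · rw [List.length_append]; exact hl.add hm
  · rw [List.map_append, List.prod_append]; exact hl'.mul hm'

theorem inv_mem_spinorKernel {Q : QuadraticForm K V} {σ : V ≃ₗ[K] V}
    (hσ : σ ∈ spinorKernel Q) : σ⁻¹ ∈ spinorKernel Q := by
  obtain ⟨l, hl, rfl, hl'⟩ := hσ
  refine ⟨l.reverse, by simpa using hl, prod_symmetry_inv Q l, ?_⟩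
  rwa [List.map_reverse, List.prod_reverse]

/-- Conjugation by `σ` turns the symmetry in `v` into the symmetry in `σ v`, and `Q (σ v) = Q v`, so
neither the parity nor the spinor norm changes. -/
theorem conj_mem_spinorKernel {Q : QuadraticForm K V} {σ τ : V ≃ₗ[K] V}
    (hσ : σ ∈ isometryGroup Q) (hτ : τ ∈ spinorKernel Q) : σ * τ * σ⁻¹ ∈ spinorKernel Q := by
  obtain ⟨l, hl, rfl, hl'⟩ := hτ
  refine ⟨l.map fun v => ⟨σ v.1, by rw [hσ]; exact v.2⟩, by simpa using hl, ?_, ?_⟩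
  · rw [← MulAut.conj_apply, map_list_prod, List.map_map, List.map_map]
    congr 2
    funext v
    exact conj_symmetry hσ v
  · rw [List.map_map]
    convert hl' using 4 with v
    exact hσ _

/-- A weak form of the Cartan–Dieudonné theorem. -/
theorem exists_eq_prod_symmetry [NeZero (2 : K)] {Q : QuadraticForm K V} {d : ℕ}
    (b : Module.Basis (Fin d) K V) (hb : ∀ i j, i ≠ j → QuadraticMap.polar Q (b i) (b j) = 0)
    (hb' : ∀ i, Q (b i) ≠ 0) {σ : V ≃ₗ[K] V} (hσ : σ ∈ isometryGroup Q) :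
    ∃ l : List {v : V // Q v ≠ 0}, σ = (l.map (symmetry Q)).prod := by
  -- The basis vectors are fixed one at a time. The next symmetries are in vectors orthogonal to
  -- those already fixed, so they do not disturb them.
  have key : ∀ k ≤ d, ∃ l : List {v : V // Q v ≠ 0}, ∀ i : Fin d, i.1 < k →
      ((l.map (symmetry Q)).prod * σ) (b i) = b i := by
    intro k
    induction k with
    | zero => exact fun _ => ⟨[], by simp⟩
    | succ k ih =>
      intro hk
      obtain ⟨l, hl⟩ := ih (by omega)
      set s := (l.map (symmetry Q)).prod * σ with hs
      have hsm : s ∈ isometryGroup Q := mul_mem (prod_symmetry_mem Q l) hσ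
      set v := b ⟨k, hk⟩ with hv
      have hv0 : Q v ≠ 0 := hb' _
      have hQ : Q (s v) = Q v := hsm v
      have hort (i : Fin d) (hi : i.1 < k) : QuadraticMap.polar Q v (b i) = 0 :=
        hb _ _ (by rintro rfl; simp at hi)
      have hort' (i : Fin d) (hi : i.1 < k) : QuadraticMap.polar Q (s v) (b i) = 0 := by
        conv_lhs => rw [← hl i hi]
        rw [polar_map_of_mem hsm, hort i hi]
      have hlt (i : Fin d) (hi : i.1 < k + 1) : i.1 < k ∨ i = ⟨k, hk⟩ := by
        rcases Nat.lt_succ_iff_lt_or_eq.1 hi with h | h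
        · exact .inl h
        · exact .inr (Fin.ext h)
      have hself : QuadraticMap.polar Q v v = 2 * Q v := by
        rw [QuadraticMap.polar_self, two_nsmul, two_mul]
      have hself' : QuadraticMap.polar Q (s v) (s v) = 2 * Q v := by
        rw [QuadraticMap.polar_self, two_nsmul, two_mul, hQ]
      -- If `s v - v` is anisotropic, its symmetry sends `s v` to `v`. Otherwise `Q (s v - v) + Q (s
      -- v + v) = 4 Q v` makes `s v + v` anisotropic; its symmetry sends `s v` to `-v`, and the
      -- symmetry in `v` corrects the sign.
      by_cases h : Q (s v - v) = 0
      · have e1 : Q (s v - v) = 2 * Q v - QuadraticMap.polar Q (s v) v := by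
          rw [sub_eq_add_neg, QuadraticMap.map_add Q, QuadraticMap.map_neg,
            QuadraticMap.polar_neg_right, hQ]
          ring
        have e2 : Q (s v + v) = 2 * Q v + QuadraticMap.polar Q (s v) v := by
          rw [QuadraticMap.map_add Q, hQ]
          ring
        have h' : Q (s v + v) ≠ 0 := by
          have : Q (s v + v) = 2 * (2 * Q v) := by linear_combination e2 - h + e1
          rw [this]
          exact mul_ne_zero two_ne_zero (mul_ne_zero two_ne_zero hv0)
        refine ⟨⟨v, hv0⟩ :: ⟨s v + v, h'⟩ :: l, fun i hi => ?_⟩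
        rw [List.map_cons, List.prod_cons, List.map_cons, List.prod_cons, mul_assoc, mul_assoc,
          ← hs, LinearEquiv.mul_apply, LinearEquiv.mul_apply]
        rcases hlt i hi with hi | rfl
        · have e3 : symmetry Q ⟨s v + v, h'⟩ (b i) = b i :=
            symmetry_apply_of_polar_eq_zero (by
              rw [QuadraticMap.polar_add_left, hort i hi, hort' i hi, add_zero])
          rw [hl i hi, e3, symmetry_apply_of_polar_eq_zero (hort i hi)]
        · rw [← hv]
          have e3 : symmetry Q ⟨s v + v, h'⟩ (s v) = -v := by
            rw [symmetry_apply, QuadraticMap.polar_add_left, hself', QuadraticMap.polar_comm Q v,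
              ← e2, inv_mul_cancel₀ h']
            simp
          have e4 : symmetry Q ⟨v, hv0⟩ v = -v := by
            rw [symmetry_apply, hself, mul_left_comm, inv_mul_cancel₀ hv0]
            module
          rw [e3, map_neg, e4, neg_neg]
      · refine ⟨⟨s v - v, h⟩ :: l, fun i hi => ?_⟩
        rw [List.map_cons, List.prod_cons, mul_assoc, ← hs, LinearEquiv.mul_apply]
        rcases hlt i hi with hi | rfl
        · rw [hl i hi, symmetry_apply_of_polar_eq_zero]
          rw [QuadraticMap.polar_sub_left, hort i hi, hort' i hi, sub_zero]
        · rw [← hv]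
          have e1 : Q (s v - v) = 2 * Q v - QuadraticMap.polar Q v (s v) := by
            rw [sub_eq_add_neg, QuadraticMap.map_add Q, QuadraticMap.map_neg,
              QuadraticMap.polar_neg_right, hQ, QuadraticMap.polar_comm]
            ring
          rw [symmetry_apply, QuadraticMap.polar_sub_left, hself', ← e1, inv_mul_cancel₀ h]
          simp
  obtain ⟨l, hl⟩ := key d le_rfl
  refine ⟨l.reverse, ?_⟩
  rw [← prod_symmetry_inv, eq_inv_iff_mul_eq_one, ← inv_eq_iff_mul_eq_one, eq_comm,
    ← mul_eq_one_iff_eq_inv]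
  apply LinearEquiv.toLinearMap_injective
  exact b.ext fun i => hl i i.2

/-- When `σ` and `τ` are written as products of symmetries, inverses reverse the lists. Each vector
then occurs twice in the commutator, so the length is even and the spinor norm is a square. -/
theorem commutator_mem_spinorKernel [NeZero (2 : K)] {Q : QuadraticForm K V} {d : ℕ}
    (b : Module.Basis (Fin d) K V) (hb : ∀ i j, i ≠ j → QuadraticMap.polar Q (b i) (b j) = 0)
    (hb' : ∀ i, Q (b i) ≠ 0) {σ τ : V ≃ₗ[K] V} (hσ : σ ∈ isometryGroup Q)
    (hτ : τ ∈ isometryGroup Q) : σ * τ * σ⁻¹ * τ⁻¹ ∈ spinorKernel Q := by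
  obtain ⟨l, rfl⟩ := exists_eq_prod_symmetry b hb hb' hσ
  obtain ⟨m, rfl⟩ := exists_eq_prod_symmetry b hb hb' hτ
  refine ⟨l ++ m ++ l.reverse ++ m.reverse, ?_, ?_, ?_⟩
  · simp only [List.length_append, List.length_reverse]
    exact ⟨l.length + m.length, by ring⟩
  · simp only [List.map_append, List.prod_append, prod_symmetry_inv]
  · simp only [List.map_append, List.prod_append, List.map_reverse, List.prod_reverse]
    exact ⟨(l.map fun v => Q v.1).prod * (m.map fun v => Q v.1).prod, by ring⟩

end Field

/-! ### Lattices and their localizations -/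

section Local

variable {V W : Type*} [AddCommGroup V] [Module ℚ V] [AddCommGroup W] [Module ℚ W]

/-- The image of a `ℤ`-lattice under a linear equivalence of rational spaces. -/
def latticeMap (e : V ≃ₗ[ℚ] W) (L : Submodule ℤ V) : Submodule ℤ W :=
  L.map (e.toLinearMap.restrictScalars ℤ)

theorem mem_latticeMap {e : V ≃ₗ[ℚ] W} {L : Submodule ℤ V} {y : W} :
    y ∈ latticeMap e L ↔ ∃ x ∈ L, e x = y := Iff.rfl

theorem exists_basis_span {d : ℕ} (hd : Module.finrank ℚ V = d) {L : Submodule ℤ V}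
    (hL : L.IsLattice ℚ) :
    ∃ b : Module.Basis (Fin d) ℚ V, L = Submodule.span ℤ (Set.range b) := by
  have b₀ := Module.Free.chooseBasis ℤ L
  have e := Module.Basis.indexEquiv (b₀.extendOfIsLattice ℚ)
    (((b₀.extendOfIsLattice ℚ)).reindex (Fintype.equivFinOfCardEq
      ((Module.finrank_eq_card_basis (b₀.extendOfIsLattice ℚ)).symm.trans hd)))
  refine ⟨(b₀.reindex e).extendOfIsLattice ℚ, ?_⟩
  have : (Set.range ((b₀.reindex e).extendOfIsLattice ℚ)) =
      L.subtype '' Set.range (b₀.reindex e) := by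
    ext x
    simp only [Set.mem_range, Module.Basis.extendOfIsLattice_apply, Module.Basis.coe_reindex,
      Function.comp_apply, Set.mem_image, exists_exists_eq_and, Submodule.subtype_apply]
  rw [this, ← Submodule.map_span, Module.Basis.span_eq, Submodule.map_top, Submodule.range_subtype]

theorem isLattice_latticeMap (e : V ≃ₗ[ℚ] W) {L : Submodule ℤ V} (hL : L.IsLattice ℚ) :
    (latticeMap e L).IsLattice ℚ where
  fg := hL.fg.map _
  span_eq_top := by
    have : (latticeMap e L : Set W) = e.toLinearMap '' L := rfl
    rw [this, ← Submodule.map_span, hL.span_eq_top, Submodule.map_top, LinearEquiv.range]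

theorem latticeMap_symm_latticeMap (e : V ≃ₗ[ℚ] W) (L : Submodule ℤ V) :
    latticeMap e.symm (latticeMap e L) = L := by
  ext x
  simp [mem_latticeMap]

theorem exists_natCast_smul_mem {L : Submodule ℤ V} (hL : L.IsLattice ℚ) (x : V) :
    ∃ k : ℕ, k ≠ 0 ∧ k • x ∈ L := by
  have hx : x ∈ Submodule.span ℚ (L : Set V) := by rw [hL.span_eq_top]; trivial
  induction hx using Submodule.span_induction with
  | mem x hx => exact ⟨1, one_ne_zero, by simpa using hx⟩
  | zero => exact ⟨1, one_ne_zero, by simp⟩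
  | add x y _ _ hx hy =>
    obtain ⟨k, hk, hkx⟩ := hx
    obtain ⟨m, hm, hmy⟩ := hy
    refine ⟨k * m, mul_ne_zero hk hm, ?_⟩
    rw [smul_add]
    refine add_mem ?_ ?_
    · rw [mul_comm, mul_smul]; exact L.smul_of_tower_mem m hkx
    · rw [mul_smul]; exact L.smul_of_tower_mem k hmy
  | smul r x _ hx =>
    obtain ⟨k, hk, hkx⟩ := hx
    refine ⟨k * r.den, mul_ne_zero hk r.den_nz, ?_⟩
    have : (k * r.den) • r • x = r.num • k • x := by
      rw [← Nat.cast_smul_eq_nsmul ℚ, ← Nat.cast_smul_eq_nsmul ℚ, ← Int.cast_smul_eq_zsmul ℚ,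
        smul_smul, smul_smul]
      congr 1
      push_cast
      linear_combination (k : ℚ) * Rat.mul_den_eq_num r
    rw [this]
    exact L.smul_mem _ hkx

theorem exists_natCast_smul_le {L L' : Submodule ℤ V} (hL : L.IsLattice ℚ)
    (hL' : L'.IsLattice ℚ) : ∃ k : ℕ, k ≠ 0 ∧ ∀ x ∈ L, k • x ∈ L' := by
  classical
  obtain ⟨s, hs⟩ := hL.fg
  choose k hk hkx using exists_natCast_smul_mem hL'
  refine ⟨∏ x ∈ s, k x, Finset.prod_ne_zero_iff.2 fun x _ => hk x, fun x hx => ?_⟩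
  rw [← hs] at hx
  induction hx using Submodule.span_induction with
  | mem x hx =>
    rw [← Finset.prod_erase_mul s k hx, mul_smul]
    exact L'.smul_of_tower_mem _ (hkx x)
  | zero => simp
  | add x y _ _ hx hy => rw [smul_add]; exact add_mem hx hy
  | smul r x _ hx => rw [smul_comm]; exact L'.smul_mem _ hx

theorem isLattice_of_smul_le {L L' : Submodule ℤ V} (hL : L.IsLattice ℚ) {k : ℕ} (hk : k ≠ 0)
    (h₁ : ∀ x ∈ L, k • x ∈ L') (h₂ : ∀ x ∈ L', k • x ∈ L) : L'.IsLattice ℚ where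
  fg := by
    have : L'.map ((k : ℤ) • (LinearMap.id : V →ₗ[ℤ] V)) ≤ L := by
      rintro _ ⟨x, hx, rfl⟩
      simpa using h₂ x hx
    have := Module.Finite.iff_fg.2 hL.fg
    have hfg : (L'.map ((k : ℤ) • (LinearMap.id : V →ₗ[ℤ] V))).FG :=
      Submodule.FG.of_le hL.fg ‹_›
    refine Submodule.fg_of_fg_map_injective _ ?_ hfg
    intro x y hxy
    have : (k : ℚ) • x = (k : ℚ) • y := by
      simpa [Nat.cast_smul_eq_nsmul] using hxy
    exact smul_right_injective V (Nat.cast_ne_zero.2 hk) this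
  span_eq_top := by
    rw [eq_top_iff, ← hL.span_eq_top, Submodule.span_le]
    intro x hx
    have h := Submodule.smul_mem (Submodule.span ℚ (L' : Set V)) (k : ℚ)⁻¹
      (Submodule.subset_span (h₁ x hx))
    rwa [← Nat.cast_smul_eq_nsmul ℚ, inv_smul_smul₀ (Nat.cast_ne_zero.2 hk)] at h

variable (p : ℕ) [Fact p.Prime]

theorem smul_mem_of_norm_le_one {p : ℕ} [Fact p.Prime] {J : Submodule ℤ_[p] (ℚ_[p] ⊗[ℚ] V)}
    {x : ℚ_[p] ⊗[ℚ] V} (hx : x ∈ J) {c : ℚ_[p]} (hc : ‖c‖ ≤ 1) : c • x ∈ J := by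
  obtain ⟨c, rfl⟩ : ∃ c' : ℤ_[p], (c' : ℚ_[p]) = c := ⟨⟨c, hc⟩, rfl⟩
  have h : c • x = (c : ℚ_[p]) • x := (algebraMap_smul ℚ_[p] c x).symm
  exact h ▸ J.smul_mem c hx

theorem localization_mono {L L' : Submodule ℤ V} (h : L ≤ L') :
    localization p L ≤ localization p L' :=
  Submodule.span_mono (Set.image_mono h)

theorem one_tmul_mem_localization {L : Submodule ℤ V} {x : V} (hx : x ∈ L) :
    (1 : ℚ_[p]) ⊗ₜ[ℚ] x ∈ localization p L :=
  Submodule.subset_span ⟨x, hx, rfl⟩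

theorem localization_span (s : Set V) : localization p (Submodule.span ℤ s) =
    Submodule.span ℤ_[p] ((fun x : V => (1 : ℚ_[p]) ⊗ₜ[ℚ] x) '' s) := by
  refine le_antisymm (Submodule.span_le.2 ?_) (Submodule.span_mono (Set.image_mono
    Submodule.subset_span))
  rintro _ ⟨x, hx, rfl⟩
  simp only [SetLike.mem_coe] at hx ⊢
  induction hx using Submodule.span_induction with
  | mem x hx => exact Submodule.subset_span ⟨x, hx, rfl⟩
  | zero => simp
  | add x y _ _ hx hy => rw [TensorProduct.tmul_add]; exact add_mem hx hy
  | smul r x _ hx =>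
    rw [TensorProduct.tmul_smul]
    exact zsmul_mem hx r

theorem mem_localization_span_iff {d : ℕ} (b : Module.Basis (Fin d) ℚ V)
    (x : ℚ_[p] ⊗[ℚ] V) : x ∈ localization p (Submodule.span ℤ (Set.range b)) ↔
      ∀ i, ‖(Algebra.TensorProduct.basis ℚ_[p] b).repr x i‖ ≤ 1 := by
  have : (fun x : V => (1 : ℚ_[p]) ⊗ₜ[ℚ] x) '' Set.range b =
      Set.range (Algebra.TensorProduct.basis ℚ_[p] b) := by
    rw [← Set.range_comp]
    congr 1
    ext i
    simp
  rw [localization_span, this, Module.Basis.mem_span_iff_repr_mem]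
  refine forall_congr' fun i => ⟨?_, fun h => ⟨⟨_, h⟩, rfl⟩⟩
  rintro ⟨y, hy⟩
  rw [← hy]
  exact y.2

/-- A prime dividing the denominator would contradict integrality at that prime. -/
theorem exists_eq_intCast_of_norm_le_one {q : ℚ}
    (h : ∀ (p : ℕ) [Fact p.Prime], ‖(q : ℚ_[p])‖ ≤ 1) : ∃ k : ℤ, q = k := by
  refine ⟨q.num, ?_⟩
  have : q.den = 1 := by
    by_contra hq
    obtain ⟨p, hp, hpq⟩ := Nat.exists_prime_and_dvd hq
    have := Fact.mk hp
    have h1 := PadicInt.isUnit_iff.1 (PadicInt.isUnit_den q (h p))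
    have h2 := (PadicInt.norm_natCast_lt_one_iff (p := p) (n := q.den)).2 hpq
    exact absurd h1 h2.ne
  exact ((Rat.den_eq_one_iff q).1 this).symm

/-- A lattice is the intersection of its localizations: in a lattice basis the coordinates are
integral at every prime, hence integers. -/
theorem mem_of_forall_mem_localization [FiniteDimensional ℚ V] {L : Submodule ℤ V}
    (hL : L.IsLattice ℚ) {x : V}
    (h : ∀ (p : ℕ) [Fact p.Prime], (1 : ℚ_[p]) ⊗ₜ[ℚ] x ∈ localization p L) : x ∈ L := by
  obtain ⟨b, rfl⟩ := exists_basis_span rfl hL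
  rw [Module.Basis.mem_span_iff_repr_mem]
  intro i
  obtain ⟨k, hk⟩ := exists_eq_intCast_of_norm_le_one (q := b.repr x i) (fun p _ => by
    have := (mem_localization_span_iff p b _).1 (h p) i
    rwa [Algebra.TensorProduct.basis_repr_tmul, Finsupp.smul_apply, one_smul,
      Finsupp.mapRange_apply] at this)
  exact ⟨k, hk.symm⟩

theorem le_of_forall_localization_le [FiniteDimensional ℚ V] {L L' : Submodule ℤ V}
    (hL' : L'.IsLattice ℚ)
    (h : ∀ (p : ℕ) [Fact p.Prime], localization p L ≤ localization p L') : L ≤ L' :=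
  fun _ hx => mem_of_forall_mem_localization hL' fun p _ => h p (one_tmul_mem_localization p hx)

theorem nsmul_one_tmul (k : ℕ) (x : V) :
    (1 : ℚ_[p]) ⊗ₜ[ℚ] (k • x) = (k : ℚ_[p]) • ((1 : ℚ_[p]) ⊗ₜ[ℚ] x) := by
  rw [TensorProduct.tmul_smul, Nat.cast_smul_eq_nsmul]

theorem natCast_smul_mem_localization {L L' : Submodule ℤ V} {k : ℕ}
    (h : ∀ x ∈ L, k • x ∈ L') {x : ℚ_[p] ⊗[ℚ] V} (hx : x ∈ localization p L) :
    (k : ℚ_[p]) • x ∈ localization p L' := by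
  induction hx using Submodule.span_induction with
  | mem x hx =>
    obtain ⟨x, hx, rfl⟩ := hx
    simp only [← nsmul_one_tmul]
    exact one_tmul_mem_localization p (h x hx)
  | zero => simp
  | add x y _ _ hx hy => rw [smul_add]; exact add_mem hx hy
  | smul r x _ hx => rw [smul_comm]; exact Submodule.smul_mem _ _ hx

theorem localization_le_of_not_dvd {L L' : Submodule ℤ V} {k : ℕ} (hp : ¬p ∣ k)
    (h : ∀ x ∈ L, k • x ∈ L') : localization p L ≤ localization p L' := by
  intro x hx
  have h1 : ‖(k : ℚ_[p])‖ = 1 := by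
    rw [← PadicInt.coe_natCast, ← PadicInt.norm_def, PadicInt.norm_natCast_eq_one_iff]
    exact (Nat.Prime.coprime_iff_not_dvd Fact.out).2 hp
  have h0 : (k : ℚ_[p]) ≠ 0 := by
    rw [← norm_ne_zero_iff, h1]
    exact one_ne_zero
  have := smul_mem_of_norm_le_one (natCast_smul_mem_localization p h hx)
    (c := (k : ℚ_[p])⁻¹) (by rw [norm_inv, h1, inv_one])
  rwa [inv_smul_smul₀ h0] at this

/-- Two full lattices are commensurable, and the localizations agree at primes not dividing the two
multipliers. -/
theorem finite_localization_ne {L L' : Submodule ℤ V} (hL : L.IsLattice ℚ)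
    (hL' : L'.IsLattice ℚ) :
    {p : Nat.Primes | haveI := Fact.mk p.2; localization p L' ≠ localization p L}.Finite := by
  obtain ⟨k, hk, h₁⟩ := exists_natCast_smul_le hL hL'
  obtain ⟨m, hm, h₂⟩ := exists_natCast_smul_le hL' hL
  refine Set.Finite.of_finite_image (f := Subtype.val)
    ((k * m).divisors.finite_toSet.subset ?_) Subtype.val_injective.injOn
  rintro _ ⟨p, hp, rfl⟩
  have := Fact.mk p.2
  simp only [Finset.mem_coe, Nat.mem_divisors]
  refine ⟨?_, mul_ne_zero hk hm⟩
  by_contra hpk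
  refine hp (le_antisymm ?_ ?_)
  · exact localization_le_of_not_dvd p.1 (fun h => hpk (h.mul_left k)) h₂
  · exact localization_le_of_not_dvd p.1 (fun h => hpk (h.mul_right m)) h₁

theorem localImage_mul (σ τ : (ℚ_[p] ⊗[ℚ] V) ≃ₗ[ℚ_[p]] (ℚ_[p] ⊗[ℚ] V))
    (J : Submodule ℤ_[p] (ℚ_[p] ⊗[ℚ] V)) :
    localImage p (σ * τ) J = localImage p σ (localImage p τ J) :=
by
  rw [localImage, localImage, localImage, ← Submodule.map_comp]
  rfl

theorem localImage_one (J : Submodule ℤ_[p] (ℚ_[p] ⊗[ℚ] V)) : localImage p 1 J = J :=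
  Submodule.map_id J

theorem localImage_mono (σ : (ℚ_[p] ⊗[ℚ] V) ≃ₗ[ℚ_[p]] (ℚ_[p] ⊗[ℚ] V))
    {J J' : Submodule ℤ_[p] (ℚ_[p] ⊗[ℚ] V)} (h : J ≤ J') :
    localImage p σ J ≤ localImage p σ J' :=
  Submodule.map_mono h

theorem localization_latticeMap (e : V ≃ₗ[ℚ] W) (L : Submodule ℤ V) :
    localization p (latticeMap e L) = (localization p L).map
      ((LinearEquiv.baseChange ℚ ℚ_[p] V W e).toLinearMap.restrictScalars ℤ_[p]) := by
  rw [localization, localization, Submodule.map_span, ← Set.image_comp]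
  have : (latticeMap e L : Set W) = e '' L := rfl
  rw [this, ← Set.image_comp]
  rfl

theorem localization_latticeMap_self (σ : V ≃ₗ[ℚ] V) (L : Submodule ℤ V) :
    localization p (latticeMap σ L) = localImage p (localMap p σ) (localization p L) :=
  localization_latticeMap p σ L

/-- A linear automorphism of `V_p` maps `L_p` into `p⁻ᵃ L_p` for some `a`. -/
theorem exists_pow_smul_mem [FiniteDimensional ℚ V] {L : Submodule ℤ V} (hL : L.IsLattice ℚ)
    (τ : (ℚ_[p] ⊗[ℚ] V) ≃ₗ[ℚ_[p]] (ℚ_[p] ⊗[ℚ] V)) :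
    ∃ a : ℕ, ∀ x ∈ localization p L, (p : ℚ_[p]) ^ a • τ x ∈ localization p L := by
  obtain ⟨b, rfl⟩ := exists_basis_span rfl hL
  set β := Algebra.TensorProduct.basis ℚ_[p] b with hβ
  have key (c : ℚ_[p]) : ∃ a : ℕ, ‖(p : ℚ_[p]) ^ a * c‖ ≤ 1 := by
    obtain ⟨a, ha⟩ := PadicInt.exists_pow_neg_lt p (ε := (‖c‖ + 1)⁻¹) (by positivity)
    refine ⟨a, ?_⟩
    rw [norm_mul, Padic.norm_p_pow]
    refine (mul_le_mul_of_nonneg_right ha.le (norm_nonneg c)).trans ?_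
    rw [inv_mul_le_iff₀ (by positivity)]
    linarith
  choose a ha using key
  -- The sum dominates the exponent of each matrix entry, so it clears all denominators at once.
  refine ⟨∑ i, ∑ j, a (β.repr (τ (β j)) i), fun x hx => ?_⟩
  have hmem (j) : (p : ℚ_[p]) ^ (∑ i, ∑ j, a (β.repr (τ (β j)) i)) • τ (β j) ∈
      localization p (Submodule.span ℤ (Set.range b)) := by
    rw [mem_localization_span_iff]
    intro i
    rw [map_smul, Finsupp.smul_apply, smul_eq_mul]
    have hle : a (β.repr (τ (β j)) i) ≤ ∑ i, ∑ j, a (β.repr (τ (β j)) i) :=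
      (Finset.single_le_sum (f := fun j => a (β.repr (τ (β j)) i)) (fun _ _ => Nat.zero_le _)
        (Finset.mem_univ j)).trans (Finset.single_le_sum
          (f := fun i => ∑ j, a (β.repr (τ (β j)) i)) (fun _ _ => Nat.zero_le _)
          (Finset.mem_univ i))
    obtain ⟨m, hm⟩ := Nat.exists_eq_add_of_le hle
    rw [hm, pow_add, mul_right_comm, norm_mul, norm_pow]
    exact mul_le_one₀ (ha _) (by positivity) (pow_le_one₀ (norm_nonneg _) Padic.norm_p_lt_one.le)
  rw [← β.sum_repr x, map_sum, Finset.smul_sum]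
  refine Submodule.sum_mem _ fun j _ => ?_
  rw [map_smul, smul_comm]
  exact smul_mem_of_norm_le_one (hmem j) ((mem_localization_span_iff p b x).1 hx j)

/-- Elements of `V_p` are approximated, modulo `pᵃ L_p`, by rational vectors that lie in `L_q` for
all `q ≠ p`. -/
theorem exists_sub_mem_localization [FiniteDimensional ℚ V] {L : Submodule ℤ V}
    (hL : L.IsLattice ℚ) (a : ℕ) {x : ℚ_[p] ⊗[ℚ] V}
    (hx : (p : ℚ_[p]) ^ a • x ∈ localization p L) :
    ∃ y : V, (p ^ a) • y ∈ L ∧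
      ∃ z ∈ localization p L, x - (1 : ℚ_[p]) ⊗ₜ[ℚ] y = (p : ℚ_[p]) ^ a • z := by
  obtain ⟨b, rfl⟩ := exists_basis_span rfl hL
  set β := Algebra.TensorProduct.basis ℚ_[p] b with hβ
  have hp0 : (p : ℚ_[p]) ≠ 0 := Nat.cast_ne_zero.2 (Fact.out : p.Prime).ne_zero
  have hpq : (p : ℚ) ≠ 0 := Nat.cast_ne_zero.2 (Fact.out : p.Prime).ne_zero
  rw [mem_localization_span_iff] at hx
  -- Precision `p ^ (2 * a)` is needed because `y` is obtained after division by `p ^ a`, and an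
  -- error divisible by `p ^ a` must remain.
  have key (i) : ∃ (k : ℕ) (c : ℤ_[p]), (p : ℚ_[p]) ^ a * β.repr x i - k =
      (p : ℚ_[p]) ^ (2 * a) * c := by
    have h := hx i
    rw [map_smul, Finsupp.smul_apply, smul_eq_mul] at h
    obtain ⟨t, ht⟩ : ∃ t : ℤ_[p], (t : ℚ_[p]) = (p : ℚ_[p]) ^ a * β.repr x i := ⟨⟨_, h⟩, rfl⟩
    obtain ⟨c, hc⟩ := Ideal.mem_span_singleton.1 (PadicInt.appr_spec (2 * a) t)
    refine ⟨t.appr (2 * a), c, ?_⟩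
    have := congrArg (fun t : ℤ_[p] => (t : ℚ_[p])) hc
    simpa [ht] using this
  choose k c hk using key
  refine ⟨∑ i, ((k i : ℚ) / p ^ a) • b i, ?_, ∑ i, (c i : ℚ_[p]) • β i, ?_, ?_⟩
  · rw [Finset.smul_sum]
    refine Submodule.sum_mem _ fun i _ => ?_
    have : (p ^ a) • ((k i : ℚ) / p ^ a) • b i = k i • b i := by
      rw [← Nat.cast_smul_eq_nsmul ℚ, ← Nat.cast_smul_eq_nsmul ℚ, smul_smul]
      congr 1
      push_cast
      field_simp
    rw [this]
    exact Submodule.smul_of_tower_mem _ _ (Submodule.subset_span ⟨i, rfl⟩)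
  · refine Submodule.sum_mem _ fun i _ => smul_mem_of_norm_le_one ?_ (c i).2
    rw [hβ, Algebra.TensorProduct.basis_apply]
    exact one_tmul_mem_localization p (Submodule.subset_span ⟨i, rfl⟩)
  · conv_lhs => rw [← β.sum_repr x]
    rw [TensorProduct.tmul_sum, ← Finset.sum_sub_distrib, Finset.smul_sum]
    refine Finset.sum_congr rfl fun i _ => ?_
    have : (1 : ℚ_[p]) ⊗ₜ[ℚ] (((k i : ℚ) / p ^ a) • b i) = ((k i : ℚ_[p]) / p ^ a) • β i := by
      rw [hβ, Algebra.TensorProduct.basis_apply, TensorProduct.tmul_smul, ← algebraMap_smul ℚ_[p]]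
      simp
    rw [this, ← sub_smul, smul_smul]
    congr 1
    have h := hk i
    field_simp
    rw [two_mul, pow_add] at h
    linear_combination h

/-- The lattice is cut out by its prescribed local conditions. It is full because it is sandwiched
between multiples of `L` by powers of `p`, and weak approximation shows that its localization at `p`
is all of `τ L_p`. -/
theorem exists_localization_eq_update [FiniteDimensional ℚ V] {L : Submodule ℤ V}
    (hL : L.IsLattice ℚ) (τ : (ℚ_[p] ⊗[ℚ] V) ≃ₗ[ℚ_[p]] (ℚ_[p] ⊗[ℚ] V)) :
    ∃ L' : Submodule ℤ V, L'.IsLattice ℚ ∧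
      localization p L' = localImage p τ (localization p L) ∧
      ∀ (q : ℕ) [Fact q.Prime], q ≠ p → localization q L' = localization q L := by
  have hp : p.Prime := Fact.out
  have hp0 : (p : ℚ_[p]) ≠ 0 := Nat.cast_ne_zero.2 hp.ne_zero
  obtain ⟨a₁, ha₁⟩ := exists_pow_smul_mem p hL τ
  obtain ⟨a₂, ha₂⟩ := exists_pow_smul_mem p hL τ.symm
  set a := a₁ + a₂ with ha
  set J := localImage p τ (localization p L) with hJ
  have hpn (m : ℕ) : ‖(p : ℚ_[p]) ^ m‖ ≤ 1 := by
    rw [norm_pow]; exact pow_le_one₀ (norm_nonneg _) Padic.norm_p_lt_one.le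
  have hJL (x) (hx : x ∈ J) : (p : ℚ_[p]) ^ a • x ∈ localization p L := by
    obtain ⟨y, hy, rfl⟩ := hx
    rw [ha, pow_add, mul_comm, mul_smul]
    exact smul_mem_of_norm_le_one (ha₁ y hy) (hpn a₂)
  have hLJ (x) (hx : x ∈ localization p L) : (p : ℚ_[p]) ^ a • x ∈ J := by
    refine ⟨(p : ℚ_[p]) ^ a • τ.symm x, ?_, ?_⟩
    · rw [ha, pow_add, mul_smul]
      exact smul_mem_of_norm_le_one (ha₂ x hx) (hpn a₁)
    · simp
  let L' : Submodule ℤ V := AddSubgroup.toIntSubmodule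
    { carrier := {x | (1 : ℚ_[p]) ⊗ₜ[ℚ] x ∈ J ∧
        ∀ (q : ℕ) [Fact q.Prime], q ≠ p → (1 : ℚ_[q]) ⊗ₜ[ℚ] x ∈ localization q L}
      zero_mem' := by simp
      add_mem' := fun {x y} hx hy => by
        simp only [Set.mem_ofPred_eq, TensorProduct.tmul_add]
        exact ⟨add_mem hx.1 hy.1, fun q _ hq => add_mem (hx.2 q hq) (hy.2 q hq)⟩
      neg_mem' := fun {x} hx => by
        simp only [Set.mem_ofPred_eq, TensorProduct.tmul_neg, neg_mem_iff]
        exact hx }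
  have memL' (x : V) : x ∈ L' ↔ (1 : ℚ_[p]) ⊗ₜ[ℚ] x ∈ J ∧
        ∀ (q : ℕ) [Fact q.Prime], q ≠ p → (1 : ℚ_[q]) ⊗ₜ[ℚ] x ∈ localization q L := Iff.rfl
  have h₁ (x) (hx : x ∈ L) : (p ^ a) • x ∈ L' := by
    rw [memL']
    refine ⟨?_, fun q _ hq => ?_⟩
    · rw [nsmul_one_tmul, Nat.cast_pow]
      exact hLJ _ (one_tmul_mem_localization p hx)
    · exact one_tmul_mem_localization q (L.smul_of_tower_mem _ hx)
  have h₂ (x) (hx : x ∈ L') : (p ^ a) • x ∈ L := by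
    rw [memL'] at hx
    refine mem_of_forall_mem_localization hL fun q _ => ?_
    by_cases hq : q = p
    · subst hq
      rw [nsmul_one_tmul, Nat.cast_pow]
      exact hJL _ hx.1
    · rw [TensorProduct.tmul_smul]
      exact nsmul_mem (hx.2 q hq) _
  have hpa : p ^ a ≠ 0 := pow_ne_zero _ hp.ne_zero
  refine ⟨L', isLattice_of_smul_le hL hpa h₁ h₂, le_antisymm ?_ ?_, fun q _ hq => ?_⟩
  · refine Submodule.span_le.2 ?_
    rintro _ ⟨x, hx, rfl⟩
    exact hx.1
  · intro x hx
    -- The error `p ^ a • z` lies in `L'_p` since `p ^ a L ≤ L'`. The rational vector `y` lies in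
    -- `L'` itself: at `q ≠ p`, `p ^ a` is a unit.
    obtain ⟨y, hy, z, hz, hxy⟩ := exists_sub_mem_localization p hL a (hJL x hx)
    have hxyL : x - (1 : ℚ_[p]) ⊗ₜ[ℚ] y ∈ localization p L' := by
      rw [hxy, ← Nat.cast_pow]
      exact natCast_smul_mem_localization p h₁ hz
    have hyL : y ∈ L' := by
      refine (memL' y).2 ⟨?_, fun q _ hq => ?_⟩
      · have : x - (x - (1 : ℚ_[p]) ⊗ₜ[ℚ] y) ∈ J := by
          refine sub_mem hx ?_
          rw [hxy]
          exact hLJ z hz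
        rwa [sub_sub_cancel] at this
      · have hle : localization q (Submodule.span ℤ {y}) ≤ localization q L :=
          localization_le_of_not_dvd q (k := p ^ a)
            (fun h => hq ((Nat.prime_dvd_prime_iff_eq Fact.out hp).1
              ((Fact.out : q.Prime).dvd_of_dvd_pow h)))
            (fun x hx => by
              obtain ⟨m, rfl⟩ := Submodule.mem_span_singleton.1 hx
              rw [smul_comm]
              exact L.smul_mem _ hy)
        exact hle (one_tmul_mem_localization q (Submodule.mem_span_singleton_self y))
    have := add_mem hxyL (one_tmul_mem_localization p hyL)
    rwa [sub_add_cancel] at this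
  · have hqa : ¬q ∣ p ^ a := fun h => hq ((Nat.prime_dvd_prime_iff_eq Fact.out hp).1
      ((Fact.out : q.Prime).dvd_of_dvd_pow h))
    exact le_antisymm (localization_le_of_not_dvd q hqa h₂) (localization_le_of_not_dvd q hqa h₁)

end Local

/-! ### Genera, spinor genera and the action of families of local isometries -/

section SpinorGenus

variable {V W : Type*} [AddCommGroup V] [Module ℚ V] [AddCommGroup W] [Module ℚ W]

instance fact_prime_primes (p : Nat.Primes) : Fact (p : ℕ).Prime := ⟨p.2⟩

/-- `L'_p = σ_p L_p` for all primes `p`. -/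
def IsLocalImage (σ : ∀ p : Nat.Primes, (ℚ_[p] ⊗[ℚ] V) ≃ₗ[ℚ_[p]] (ℚ_[p] ⊗[ℚ] V))
    (L L' : Submodule ℤ V) : Prop :=
  ∀ p : Nat.Primes, localization p L' = localImage p (σ p) (localization p L)

theorem exists_isLocalImage [FiniteDimensional ℚ V] {L : Submodule ℤ V} (hL : L.IsLattice ℚ)
    {σ : ∀ p : Nat.Primes, (ℚ_[p] ⊗[ℚ] V) ≃ₗ[ℚ_[p]] (ℚ_[p] ⊗[ℚ] V)}
    (hσ : {p | σ p ≠ 1}.Finite) : ∃ L' : Submodule ℤ V, L'.IsLattice ℚ ∧ IsLocalImage σ L L' := by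
  classical
  have key (S : Finset Nat.Primes) : ∃ L' : Submodule ℤ V, L'.IsLattice ℚ ∧
      ∀ p : Nat.Primes, localization p L' =
        if p ∈ S then localImage p (σ p) (localization p L) else localization p L := by
    induction S using Finset.induction_on with
    | empty => exact ⟨L, hL, by simp⟩
    | insert q S hq ih =>
      obtain ⟨K, hK, h⟩ := ih
      obtain ⟨L', hL', h₁, h₂⟩ := exists_localization_eq_update q.1 hK (σ q)
      refine ⟨L', hL', fun p => ?_⟩
      by_cases hpq : p = q
      · subst hpq
        rw [if_pos (Finset.mem_insert_self _ _), h₁, h, if_neg hq]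
      · rw [h₂ p (fun h => hpq (Subtype.ext h)), h]
        simp [hpq]
  obtain ⟨L', hL', h⟩ := key hσ.toFinset
  refine ⟨L', hL', fun p => ?_⟩
  rw [h]
  split_ifs with hp
  · rfl
  · have : σ p = 1 := by simpa using hp
    rw [this, localImage_one]

theorem IsLocalImage.le [FiniteDimensional ℚ V] {L M L' M' : Submodule ℤ V}
    {σ : ∀ p : Nat.Primes, (ℚ_[p] ⊗[ℚ] V) ≃ₗ[ℚ_[p]] (ℚ_[p] ⊗[ℚ] V)}
    (hL : IsLocalImage σ L L') (hM : IsLocalImage σ M M') (hM' : M'.IsLattice ℚ)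
    (h : L ≤ M) : L' ≤ M' := by
  refine le_of_forall_localization_le hM' fun p hp => ?_
  have h₁ := hL ⟨p, hp.out⟩
  have h₂ := hM ⟨p, hp.out⟩
  simp only at h₁ h₂
  rw [h₁, h₂]
  exact localImage_mono p _ (localization_mono p h)

theorem IsLocalImage.inv {L L' : Submodule ℤ V}
    {σ : ∀ p : Nat.Primes, (ℚ_[p] ⊗[ℚ] V) ≃ₗ[ℚ_[p]] (ℚ_[p] ⊗[ℚ] V)}
    (h : IsLocalImage σ L L') : IsLocalImage (fun p => (σ p)⁻¹) L' L := by
  intro p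
  rw [h p, ← localImage_mul, inv_mul_cancel, localImage_one]

theorem localMap_mul (p : ℕ) [Fact p.Prime] (s t : V ≃ₗ[ℚ] V) :
    localMap p (s * t) = localMap p s * localMap p t := by
  apply LinearEquiv.toLinearMap_injective
  exact LinearMap.baseChange_comp _ _

theorem localMap_one (p : ℕ) [Fact p.Prime] : localMap p (1 : V ≃ₗ[ℚ] V) = 1 := by
  apply LinearEquiv.toLinearMap_injective
  exact LinearMap.baseChange_id

theorem localMap_inv (p : ℕ) [Fact p.Prime] (s : V ≃ₗ[ℚ] V) :
    localMap p s⁻¹ = (localMap p s)⁻¹ :=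
  eq_inv_of_mul_eq_one_left (by rw [← localMap_mul, inv_mul_cancel, localMap_one])

theorem localForm_baseChange_apply (p : ℕ) [Fact p.Prime] {Q : QuadraticForm ℚ V}
    {R : QuadraticForm ℚ W} {e : V ≃ₗ[ℚ] W} {c : ℚ} (h : ∀ x, R (e x) = c * Q x)
    (x : ℚ_[p] ⊗[ℚ] V) :
    localForm p R (LinearEquiv.baseChange ℚ ℚ_[p] V W e x) = c * localForm p Q x := by
  have : (localForm p R).comp (LinearEquiv.baseChange ℚ ℚ_[p] V W e).toLinearMap =
      (c : ℚ_[p]) • localForm p Q := by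
    apply baseChange_ext
    intro x
    have h₁ : (LinearEquiv.baseChange ℚ ℚ_[p] V W e) (1 ⊗ₜ x) = 1 ⊗ₜ e x := rfl
    simp only [QuadraticMap.comp_apply, LinearEquiv.coe_coe, h₁, localForm,
      QuadraticForm.baseChange_tmul, h, smul_apply, mul_one, mul_smul]
    simp [Algebra.smul_def]
  exact congrArg (fun F => F x) this

theorem localMap_mem (p : ℕ) [Fact p.Prime] {Q : QuadraticForm ℚ V} {s : V ≃ₗ[ℚ] V}
    (hs : s ∈ isometryGroup Q) : localMap p s ∈ isometryGroup (localForm p Q) := by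
  intro x
  have := localForm_baseChange_apply p (R := Q) (e := s) (c := 1)
    (fun x => (hs x).trans (one_mul _).symm) x
  rw [Rat.cast_one, one_mul] at this
  exact this

/-- Although `V_p` may be isotropic, an orthogonal basis of the positive definite space `V` remains
an orthogonal basis of anisotropic vectors over `ℚ_p`. -/
theorem commutator_mem_spinorKernel_localForm [FiniteDimensional ℚ V] (p : ℕ) [Fact p.Prime]
    {Q : QuadraticForm ℚ V} (hQ : Q.PosDef) {σ τ : (ℚ_[p] ⊗[ℚ] V) ≃ₗ[ℚ_[p]] (ℚ_[p] ⊗[ℚ] V)}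
    (hσ : σ ∈ isometryGroup (localForm p Q)) (hτ : τ ∈ isometryGroup (localForm p Q)) :
    σ * τ * σ⁻¹ * τ⁻¹ ∈ spinorKernel (localForm p Q) := by
  obtain ⟨b, hb⟩ := LinearMap.BilinForm.exists_orthogonal_basis
    (B := QuadraticMap.associated (R := ℚ) Q) ⟨QuadraticMap.associated_isSymm ℚ Q⟩
  refine commutator_mem_spinorKernel (Algebra.TensorProduct.basis ℚ_[p] b) ?_ ?_ hσ hτ
  · intro i j hij
    have h : QuadraticMap.polar Q (b i) (b j) = 0 := by
      have := hb hij
      rw [Function.onFun] at this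
      rw [← QuadraticMap.polarBilin_apply_apply, ← QuadraticMap.two_nsmul_associated ℚ Q]
      exact (congrArg (2 • ·) this).trans (smul_zero 2)
    rw [QuadraticMap.polar] at h ⊢
    rw [Algebra.TensorProduct.basis_apply, Algebra.TensorProduct.basis_apply,
      ← TensorProduct.tmul_add]
    simp only [localForm, QuadraticForm.baseChange_tmul, ← sub_smul, h, zero_smul]
  · intro i
    rw [Algebra.TensorProduct.basis_apply, localForm, QuadraticForm.baseChange_tmul, mul_one,
      Algebra.smul_def, mul_one]
    simpa using (hQ (b i) (b.ne_zero i)).ne'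

theorem mem_spn_iff {Q : QuadraticForm ℚ V} {L L' : Submodule ℤ V} :
    L' ∈ spn Q L ↔ L'.IsLattice ℚ ∧ ∃ s ∈ isometryGroup Q, ∀ p : Nat.Primes,
      ∃ τ ∈ spinorKernel (localForm p Q),
        localization p L' = localImage p (localMap p s * τ) (localization p L) := by
  refine and_congr_right fun _ => ⟨?_, ?_⟩
  · rintro ⟨s, hs⟩
    refine ⟨s.toLinearEquiv, s.map_app', fun p => ?_⟩
    obtain ⟨τ, hτ, h⟩ := hs p
    exact ⟨τ, hτ, by rw [h, localImage_mul]⟩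
  · rintro ⟨s, hs, h⟩
    refine ⟨⟨s, hs⟩, fun p hp => ?_⟩
    obtain ⟨τ, hτ, h⟩ := h ⟨p, hp.out⟩
    exact ⟨τ, hτ, h.trans (localImage_mul p _ _ _)⟩

theorem mem_gen_iff {Q : QuadraticForm ℚ V} {L L' : Submodule ℤ V} :
    L' ∈ gen Q L ↔ L'.IsLattice ℚ ∧ ∀ p : Nat.Primes, ∃ σ ∈ isometryGroup (localForm p Q),
      localization p L' = localImage p σ (localization p L) := by
  refine and_congr_right fun _ => ⟨fun h p => ?_, fun h p hp => ?_⟩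
  · obtain ⟨σ, hσ⟩ := h p
    exact ⟨σ.toLinearEquiv, σ.map_app', hσ⟩
  · obtain ⟨σ, hσ, h⟩ := h ⟨p, hp.out⟩
    exact ⟨⟨σ, hσ⟩, h⟩

theorem mem_gen_self (Q : QuadraticForm ℚ V) {L : Submodule ℤ V} (hL : L.IsLattice ℚ) :
    L ∈ gen Q L :=
  mem_gen_iff.2 ⟨hL, fun p => ⟨1, one_mem _, (localImage_one p _).symm⟩⟩

theorem mem_gen_trans {Q : QuadraticForm ℚ V} {L L' L'' : Submodule ℤ V} (h : L' ∈ gen Q L)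
    (h' : L'' ∈ gen Q L') : L'' ∈ gen Q L := by
  rw [mem_gen_iff] at *
  refine ⟨h'.1, fun p => ?_⟩
  obtain ⟨σ, hσ, e⟩ := h.2 p
  obtain ⟨τ, hτ, e'⟩ := h'.2 p
  exact ⟨τ * σ, mul_mem hτ hσ, by rw [e', e, localImage_mul]⟩

theorem mem_gen_symm {Q : QuadraticForm ℚ V} {L L' : Submodule ℤ V} (hL : L.IsLattice ℚ)
    (h : L' ∈ gen Q L) : L ∈ gen Q L' := by
  rw [mem_gen_iff] at *
  refine ⟨hL, fun p => ?_⟩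
  obtain ⟨σ, hσ, e⟩ := h.2 p
  exact ⟨σ⁻¹, inv_mem hσ, by rw [e, ← localImage_mul, inv_mul_cancel, localImage_one]⟩

theorem mem_gen_of_isLocalImage {Q : QuadraticForm ℚ V} {L L' : Submodule ℤ V}
    (hL' : L'.IsLattice ℚ) {σ : ∀ p : Nat.Primes, (ℚ_[p] ⊗[ℚ] V) ≃ₗ[ℚ_[p]] (ℚ_[p] ⊗[ℚ] V)}
    (hσ : ∀ p : Nat.Primes, σ p ∈ isometryGroup (localForm p Q)) (h : IsLocalImage σ L L') : L' ∈ gen Q L :=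
  mem_gen_iff.2 ⟨hL', fun p => ⟨σ p, hσ p, h p⟩⟩

theorem exists_isLocalImage_of_mem_gen {Q : QuadraticForm ℚ V} {L L' : Submodule ℤ V}
    (hL : L.IsLattice ℚ) (h : L' ∈ gen Q L) :
    ∃ σ : ∀ p : Nat.Primes, (ℚ_[p] ⊗[ℚ] V) ≃ₗ[ℚ_[p]] (ℚ_[p] ⊗[ℚ] V),
      (∀ p : Nat.Primes, σ p ∈ isometryGroup (localForm p Q)) ∧ {p | σ p ≠ 1}.Finite ∧ IsLocalImage σ L L' := by
  classical
  rw [mem_gen_iff] at h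
  obtain ⟨hL', h⟩ := h
  choose σ hσ e using h
  -- Taking `1` wherever the localizations agree makes the family trivial at almost all primes.
  refine ⟨fun p => if localization p L' = localization p L then 1 else σ p, fun p => ?_, ?_,
    fun p => ?_⟩
  · dsimp only
    split_ifs
    · exact one_mem _
    · exact hσ p
  · refine (finite_localization_ne hL hL').subset fun p hp => ?_
    simp only [ne_eq, Set.mem_ofPred_eq, ite_eq_left_iff, Classical.not_imp] at hp ⊢
    exact hp.1
  · dsimp only
    split_ifs with hp
    · rw [localImage_one, hp]
    · exact e p

theorem mem_spn_self (Q : QuadraticForm ℚ V) {L : Submodule ℤ V} (hL : L.IsLattice ℚ) :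
    L ∈ spn Q L :=
  mem_spn_iff.2 ⟨hL, 1, one_mem _, fun p => ⟨1, one_mem_spinorKernel _, by
    rw [localMap_one, one_mul, localImage_one]⟩⟩

theorem mem_spn_trans {Q : QuadraticForm ℚ V} {L L' L'' : Submodule ℤ V} (h : L' ∈ spn Q L)
    (h' : L'' ∈ spn Q L') : L'' ∈ spn Q L := by
  rw [mem_spn_iff] at *
  obtain ⟨hL', s, hs, h⟩ := h
  obtain ⟨hL'', t, ht, h'⟩ := h'
  refine ⟨hL'', t * s, mul_mem ht hs, fun p => ?_⟩
  obtain ⟨σ, hσ, e⟩ := h p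
  obtain ⟨τ, hτ, e'⟩ := h' p
  -- Moving `τ` past `s` replaces it by its conjugate under `s⁻¹`, which stays in `O'(V_p)`.
  refine ⟨((localMap p s)⁻¹ * τ * (localMap p s)⁻¹⁻¹) * σ, mul_mem_spinorKernel
    (conj_mem_spinorKernel (inv_mem (localMap_mem p hs)) hτ) hσ, ?_⟩
  rw [e', e, ← localImage_mul, localMap_mul]
  congr 1
  group

theorem mem_spn_symm {Q : QuadraticForm ℚ V} {L L' : Submodule ℤ V} (hL : L.IsLattice ℚ)
    (h : L' ∈ spn Q L) : L ∈ spn Q L' := by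
  rw [mem_spn_iff] at *
  obtain ⟨hL', s, hs, h⟩ := h
  refine ⟨hL, s⁻¹, inv_mem hs, fun p => ?_⟩
  obtain ⟨σ, hσ, e⟩ := h p
  refine ⟨localMap p s * σ⁻¹ * (localMap p s)⁻¹,
    conj_mem_spinorKernel (localMap_mem p hs) (inv_mem_spinorKernel hσ), ?_⟩
  rw [e, ← localImage_mul, localMap_inv]
  conv_lhs => rw [← localImage_one p (localization p L)]
  congr 1
  group

theorem spn_eq_of_mem {Q : QuadraticForm ℚ V} {L L' : Submodule ℤ V} (hL : L.IsLattice ℚ)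
    (h : L' ∈ spn Q L) : spn Q L' = spn Q L :=
  Set.ext fun _ => ⟨mem_spn_trans h, mem_spn_trans (mem_spn_symm hL h)⟩

theorem latticeMap_mem_spn {Q : QuadraticForm ℚ V} {L : Submodule ℤ V} (hL : L.IsLattice ℚ)
    {s : V ≃ₗ[ℚ] V} (hs : s ∈ isometryGroup Q) : latticeMap s L ∈ spn Q L :=
  mem_spn_iff.2 ⟨isLattice_latticeMap s hL, s, hs, fun p => ⟨1, one_mem_spinorKernel _, by
    rw [mul_one, localization_latticeMap_self]⟩⟩

/-- Local isometries act on spinor genera. -/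
theorem mem_spn_of_isLocalImage [FiniteDimensional ℚ V] {Q : QuadraticForm ℚ V} (hQ : Q.PosDef)
    {σ : ∀ p : Nat.Primes, (ℚ_[p] ⊗[ℚ] V) ≃ₗ[ℚ_[p]] (ℚ_[p] ⊗[ℚ] V)}
    (hσ : ∀ p : Nat.Primes, σ p ∈ isometryGroup (localForm p Q)) {L L' K K' : Submodule ℤ V}
    (hK' : K'.IsLattice ℚ) (h : L' ∈ spn Q L) (hK : IsLocalImage σ L K)
    (hKK : IsLocalImage σ L' K') : K' ∈ spn Q K := by
  rw [mem_spn_iff] at *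
  obtain ⟨-, s, hs, h⟩ := h
  refine ⟨hK', s, hs, fun p => ?_⟩
  obtain ⟨τ, hτ, e⟩ := h p
  have hs' := localMap_mem p hs
  -- Writing `s` for its extension to `V_p`, the identity is `σ s τ = s (s⁻¹ σ s σ⁻¹) (σ τ σ⁻¹) σ`;
  -- both brackets lie in `O'(V_p)`.
  refine ⟨_, mul_mem_spinorKernel
    (commutator_mem_spinorKernel_localForm p hQ (inv_mem hs') (hσ p))
    (conj_mem_spinorKernel (hσ p) hτ), ?_⟩
  rw [hKK p, e, hK p, ← localImage_mul, ← localImage_mul]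
  congr 1
  group

end SpinorGenus

/-! ### Invariants of the genus: Gram determinant and integrality -/

section GramDet

variable {V : Type*} [AddCommGroup V] [Module ℚ V]

/-- The determinant of the Gram matrix of the polar form. -/
def gramDet {K E : Type*} [Field K] [AddCommGroup E] [Module K E] {d : ℕ} (Q : QuadraticForm K E)
    (b : Module.Basis (Fin d) K E) : K :=
  (LinearMap.BilinForm.toMatrix b Q.polarBilin).det

theorem det_toMatrix_comp {K E : Type*} [Field K] [AddCommGroup E] [Module K E] {d : ℕ}
    (Q : QuadraticForm K E) (b : Module.Basis (Fin d) K E) (f : E →ₗ[K] E) :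
    (LinearMap.BilinForm.toMatrix b (LinearMap.BilinForm.comp Q.polarBilin f f)).det =
      LinearMap.det f ^ 2 * gramDet Q b := by
  rw [LinearMap.BilinForm.toMatrix_comp b b, Matrix.det_mul, Matrix.det_mul,
    Matrix.det_transpose, LinearMap.det_toMatrix, gramDet]
  ring

theorem gramDet_localForm (p : ℕ) [Fact p.Prime] {d : ℕ} (Q : QuadraticForm ℚ V)
    (b : Module.Basis (Fin d) ℚ V) :
    gramDet (localForm p Q) (Algebra.TensorProduct.basis ℚ_[p] b) = ((gramDet Q b : ℚ) : ℚ_[p]) := by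
  rw [gramDet, gramDet]
  refine Eq.trans ?_ (RingHom.map_det (algebraMap ℚ ℚ_[p]) _).symm
  congr 1
  ext i j
  simp only [LinearMap.BilinForm.toMatrix_apply, QuadraticMap.polarBilin_apply_apply,
    QuadraticMap.polar, Algebra.TensorProduct.basis_apply, ← TensorProduct.tmul_add,
    localForm, QuadraticForm.baseChange_tmul, RingHom.mapMatrix_apply, Matrix.map_apply, map_sub]
  simp [Algebra.smul_def]

theorem norm_det_le_one_of_localImage_le {p : ℕ} [Fact p.Prime] {d : ℕ}
    (b : Module.Basis (Fin d) ℚ V) {u : (ℚ_[p] ⊗[ℚ] V) ≃ₗ[ℚ_[p]] (ℚ_[p] ⊗[ℚ] V)}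
    (hu : localImage p u (localization p (Submodule.span ℤ (Set.range b))) ≤
      localization p (Submodule.span ℤ (Set.range b))) :
    ‖LinearMap.det u.toLinearMap‖ ≤ 1 := by
  set β := Algebra.TensorProduct.basis ℚ_[p] b with hβ
  have key (i j) : ‖β.repr (u (β j)) i‖ ≤ 1 := by
    refine (mem_localization_span_iff p b _).1 (hu ⟨β j, ?_, rfl⟩) i
    rw [hβ, Algebra.TensorProduct.basis_apply]
    exact one_tmul_mem_localization p (Submodule.subset_span ⟨j, rfl⟩)
  let A : Matrix (Fin d) (Fin d) ℤ_[p] := fun i j => ⟨β.repr (u (β j)) i, key i j⟩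
  have hA : LinearMap.toMatrix β β u.toLinearMap = (algebraMap ℤ_[p] ℚ_[p]).mapMatrix A := by
    ext i j
    rw [LinearMap.toMatrix_apply]
    rfl
  rw [← LinearMap.det_toMatrix β, hA, ← RingHom.map_det]
  exact A.det.2

theorem norm_det_eq_one_of_localImage_eq {p : ℕ} [Fact p.Prime] {d : ℕ}
    (b : Module.Basis (Fin d) ℚ V) {u : (ℚ_[p] ⊗[ℚ] V) ≃ₗ[ℚ_[p]] (ℚ_[p] ⊗[ℚ] V)}
    (hu : localImage p u (localization p (Submodule.span ℤ (Set.range b))) =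
      localization p (Submodule.span ℤ (Set.range b))) :
    ‖LinearMap.det u.toLinearMap‖ = 1 := by
  have h₁ := norm_det_le_one_of_localImage_le b hu.le
  have hu' : localImage p u⁻¹ (localization p (Submodule.span ℤ (Set.range b))) =
      localization p (Submodule.span ℤ (Set.range b)) := by
    conv_lhs => rw [← hu]
    rw [← localImage_mul, inv_mul_cancel, localImage_one]
  have h₂ := norm_det_le_one_of_localImage_le b hu'.le
  have h₃ : LinearMap.det u.toLinearMap * LinearMap.det (u⁻¹).toLinearMap = 1 :=
    LinearEquiv.det_mul_det_symm u
  have h₄ := congrArg norm h₃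
  rw [norm_mul, norm_one] at h₄
  refine le_antisymm h₁ ?_
  rw [← h₄]
  exact mul_le_of_le_one_right (norm_nonneg _) h₂

/-- The Gram determinant is, up to sign, an invariant of the genus. -/
theorem abs_gramDet_eq_of_mem_gen {d : ℕ} {Q : QuadraticForm ℚ V}
    (b b' : Module.Basis (Fin d) ℚ V)
    (h : Submodule.span ℤ (Set.range b') ∈ gen Q (Submodule.span ℤ (Set.range b))) :
    |gramDet Q b'| = |gramDet Q b| := by
  have : FiniteDimensional ℚ V := b.finiteDimensional_of_finite
  set t := b.equiv b' (Equiv.refl _) with ht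
  have htb (i) : t (b i) = b' i := by simp [ht]
  have hL' : latticeMap t (Submodule.span ℤ (Set.range b)) = Submodule.span ℤ (Set.range b') := by
    rw [latticeMap, Submodule.map_span, ← Set.range_comp]
    congr 2
    ext i
    exact htb i
  have hdet : gramDet Q b' = LinearMap.det t.toLinearMap ^ 2 * gramDet Q b := by
    rw [← det_toMatrix_comp, gramDet]
    congr 1
    ext i j
    simp [LinearMap.BilinForm.toMatrix_apply, htb]
  by_cases h0 : gramDet Q b = 0
  · simp [hdet, h0]
  -- The map `σ⁻¹ t` stabilizes `L_p`, so its determinant is a unit. Since `σ` is an isometry, `t`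
  -- and `σ⁻¹ t` scale the nonzero Gram determinant by the same square.
  have hnorm (p : ℕ) [hp : Fact p.Prime] : ‖((LinearMap.det t.toLinearMap : ℚ) : ℚ_[p])‖ = 1 := by
    obtain ⟨σ, hσ, e⟩ := (mem_gen_iff.1 h).2 ⟨p, hp.out⟩
    simp only at σ hσ e
    have hu := norm_det_eq_one_of_localImage_eq b (u := σ⁻¹ * localMap p t) (by
      rw [localImage_mul, ← localization_latticeMap_self, hL', e, ← localImage_mul,
        inv_mul_cancel, localImage_one])
    have h₁ := det_toMatrix_comp (localForm p Q) (Algebra.TensorProduct.basis ℚ_[p] b)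
      (σ⁻¹ * localMap p t).toLinearMap
    have h₂ := det_toMatrix_comp (localForm p Q) (Algebra.TensorProduct.basis ℚ_[p] b)
      (localMap p t).toLinearMap
    have h₃ : LinearMap.BilinForm.comp (localForm p Q).polarBilin
        (σ⁻¹ * localMap p t).toLinearMap (σ⁻¹ * localMap p t).toLinearMap =
        LinearMap.BilinForm.comp (localForm p Q).polarBilin
          (localMap p t).toLinearMap (localMap p t).toLinearMap := by
      ext x y
      exact polar_map_of_mem (inv_mem hσ) _ _
    rw [h₃, h₂, gramDet_localForm] at h₁
    have h₄ := congrArg norm (mul_right_cancel₀ (Rat.cast_ne_zero.2 h0) h₁)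
    rw [norm_pow, norm_pow, hu, one_pow] at h₄
    have h₅ : LinearMap.det (localMap p t).toLinearMap = ((LinearMap.det t.toLinearMap : ℚ) : ℚ_[p]) :=
      LinearMap.det_baseChange _
    rw [h₅] at h₄
    exact (pow_eq_one_iff_of_nonneg (norm_nonneg _) two_ne_zero).1 h₄
  -- A rational number that is a unit at every prime is `1` or `-1`.
  obtain ⟨k, hk⟩ := exists_eq_intCast_of_norm_le_one (fun p _ => (hnorm p).le)
  obtain ⟨m, hm⟩ := exists_eq_intCast_of_norm_le_one (q := (LinearMap.det t.toLinearMap)⁻¹)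
    (fun p _ => by rw [Rat.cast_inv, norm_inv, hnorm p, inv_one])
  have hkm : k * m = 1 := by
    have := mul_inv_cancel₀ (LinearEquiv.isUnit_det' t).ne_zero
    rw [hm] at this
    rw [hk] at this
    exact_mod_cast this
  have hk1 : LinearMap.det t.toLinearMap ^ 2 = 1 := by
    rw [hk]
    rcases Int.isUnit_iff.1 (IsUnit.of_mul_eq_one m hkm) with rfl | rfl <;> norm_num
  rw [hdet, hk1, one_mul]

/-- The polar form, as a difference of values of `Q`, is also integral on `L`. It has no factor
`1/2`, so the extension to the `ℤ_p`-span works at `p = 2` too. -/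
theorem norm_localForm_le_one (p : ℕ) [Fact p.Prime] {Q : QuadraticForm ℚ V} {L : Submodule ℤ V}
    (hL : ∀ x ∈ L, ∃ k : ℤ, Q x = k) {x : ℚ_[p] ⊗[ℚ] V} (hx : x ∈ localization p L) :
    ‖localForm p Q x‖ ≤ 1 := by
  have h₁ (x) (hx : x ∈ L) : ‖localForm p Q (1 ⊗ₜ x)‖ ≤ 1 := by
    obtain ⟨k, hk⟩ := hL x hx
    rw [localForm, QuadraticForm.baseChange_tmul, mul_one, hk, Algebra.smul_def, mul_one]
    simpa using Padic.norm_int_le_one (p := p) k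
  have hadd {a b : ℚ_[p]} (ha : ‖a‖ ≤ 1) (hb : ‖b‖ ≤ 1) : ‖a + b‖ ≤ 1 :=
    (Padic.nonarchimedean a b).trans (max_le ha hb)
  have hsub {a b : ℚ_[p]} (ha : ‖a‖ ≤ 1) (hb : ‖b‖ ≤ 1) : ‖a - b‖ ≤ 1 := by
    rw [sub_eq_add_neg]
    exact hadd ha (by rwa [norm_neg])
  have hmul {a b : ℚ_[p]} (ha : ‖a‖ ≤ 1) (hb : ‖b‖ ≤ 1) : ‖a * b‖ ≤ 1 := by
    rw [norm_mul]
    exact mul_le_one₀ ha (norm_nonneg _) hb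
  have hsmul (r : ℤ_[p]) (x : ℚ_[p] ⊗[ℚ] V) : r • x = (r : ℚ_[p]) • x :=
    (algebraMap_smul ℚ_[p] r x).symm
  have h₂ {x y} (hx : x ∈ localization p L) (hy : y ∈ localization p L) :
      ‖QuadraticMap.polar (localForm p Q) x y‖ ≤ 1 := by
    induction hx, hy using Submodule.span_induction₂ with
    | mem_mem x y hx hy =>
      obtain ⟨x, hx, rfl⟩ := hx
      obtain ⟨y, hy, rfl⟩ := hy
      rw [QuadraticMap.polar, ← TensorProduct.tmul_add]
      exact hsub (hsub (h₁ _ (add_mem hx hy)) (h₁ x hx)) (h₁ y hy)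
    | zero_left y _ => simp
    | zero_right x _ => simp
    | add_left x y z _ _ _ h h' => rw [QuadraticMap.polar_add_left]; exact hadd h h'
    | add_right x y z _ _ _ h h' => rw [QuadraticMap.polar_add_right]; exact hadd h h'
    | smul_left r x y _ _ h =>
      rw [hsmul, QuadraticMap.polar_smul_left]
      exact hmul r.2 h
    | smul_right r x y _ _ h =>
      rw [hsmul, QuadraticMap.polar_smul_right]
      exact hmul r.2 h
  induction hx using Submodule.span_induction with
  | mem x hx =>
    obtain ⟨x, hx, rfl⟩ := hx
    exact h₁ x hx
  | zero => simp
  | add x y hx hy h h' =>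
    rw [QuadraticMap.map_add (localForm p Q)]
    exact hadd (hadd h h') (h₂ hx hy)
  | smul r x _ h =>
    rw [hsmul, QuadraticMap.map_smul]
    exact hmul (hmul r.2 r.2) h

theorem integral_of_mem_gen {Q : QuadraticForm ℚ V} {L L' : Submodule ℤ V}
    (hL : ∀ x ∈ L, ∃ k : ℤ, Q x = k) (h : L' ∈ gen Q L) : ∀ x ∈ L', ∃ k : ℤ, Q x = k := by
  intro x hx
  refine exists_eq_intCast_of_norm_le_one fun p hp => ?_
  obtain ⟨σ, hσ, e⟩ := (mem_gen_iff.1 h).2 ⟨p, hp.out⟩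
  simp only at σ hσ e
  have hx' := one_tmul_mem_localization p hx
  rw [e] at hx'
  obtain ⟨y, hy, hxy⟩ := hx'
  have h₁ := norm_localForm_le_one p hL hy
  have h₂ : localForm p Q (σ y) = localForm p Q y := hσ y
  have h₃ : σ y = 1 ⊗ₜ x := hxy
  rw [← h₂, h₃, localForm, QuadraticForm.baseChange_tmul, mul_one, Algebra.smul_def, mul_one] at h₁
  simpa using h₁

end GramDet

/-! ### The determinant inequality for reduced ternary forms -/

section Reduction

/-- The right side is the determinant of the symmetric matrix with diagonal `2a, 2b, 2c` and
off-diagonal entries `r, s, t`. If `r s t ≥ 0`, each of the three negative terms costs at most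
`2abc`. If `r s t < 0`, the sign conditions give `|r| + |s| + |t| ≤ a + b`, so those terms cost at
most `4abc` together and the product term at most `2abc`. -/
theorem mul_le_det_of_sorted {a b c r s t : ℚ} (ha : 0 ≤ a) (hab : a ≤ b) (hbc : b ≤ c)
    (hr : |r| ≤ a) (hs : |s| ≤ a) (ht : |t| ≤ b)
    (h₁ : 0 ≤ a + b + r + s + t) (h₂ : 0 ≤ a + b + r - s - t) (h₃ : 0 ≤ a + b - r + s - t)
    (h₄ : 0 ≤ a + b - r - s + t) :
    2 * (a * b * c) ≤
      8 * (a * b * c) + 2 * (r * s * t) - 2 * (a * t ^ 2) - 2 * (b * s ^ 2) - 2 * (c * r ^ 2) := by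
  have hb : 0 ≤ b := ha.trans hab
  have hc : 0 ≤ c := hb.trans hbc
  have r0 := abs_nonneg r
  have s0 := abs_nonneg s
  have t0 := abs_nonneg t
  rw [← sq_abs r, ← sq_abs s, ← sq_abs t]
  have eprod : |r * s * t| = |r| * |s| * |t| := by rw [abs_mul, abs_mul]
  have e₁ : c * |r| ^ 2 ≤ a * c * |r| := by
    have := mul_le_mul_of_nonneg_left hr (mul_nonneg hc r0)
    linarith
  have e₂ : b * |s| ^ 2 ≤ a * c * |s| := by
    have h₁ := mul_le_mul_of_nonneg_left hs (mul_nonneg hb s0)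
    have h₂ := mul_le_mul_of_nonneg_left hbc (mul_nonneg ha s0)
    linarith
  have e₃ : a * |t| ^ 2 ≤ a * c * |t| := by
    have h₁ := mul_le_mul_of_nonneg_left ht (mul_nonneg ha t0)
    have h₂ := mul_le_mul_of_nonneg_left hbc (mul_nonneg ha t0)
    linarith
  have hac : 0 ≤ a * c := mul_nonneg ha hc
  have e₄ : a * c * a ≤ a * c * b := mul_le_mul_of_nonneg_left hab hac
  by_cases hpos : 0 ≤ r * s * t
  · have f₁ := mul_le_mul_of_nonneg_left hr hac
    have f₂ := mul_le_mul_of_nonneg_left hs hac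
    have f₃ := mul_le_mul_of_nonneg_left ht hac
    linarith
  · have hsum : |r| + |s| + |t| ≤ a + b := by
      push Not at hpos
      rcases le_or_gt 0 r with hr' | hr' <;> rcases le_or_gt 0 s with hs' | hs' <;>
        rcases le_or_gt 0 t with ht' | ht'
      · exact absurd hpos (not_lt.2 (by positivity))
      · rw [abs_of_nonneg hr', abs_of_nonneg hs', abs_of_neg ht']; linarith
      · rw [abs_of_nonneg hr', abs_of_neg hs', abs_of_nonneg ht']; linarith
      · exact absurd hpos (not_lt.2 (mul_nonneg_of_nonpos_of_nonpos
          (mul_nonpos_of_nonneg_of_nonpos hr' hs'.le) ht'.le))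
      · rw [abs_of_neg hr', abs_of_nonneg hs', abs_of_nonneg ht']; linarith
      · exact absurd hpos (not_lt.2 (mul_nonneg_of_nonpos_of_nonpos
          (mul_nonpos_of_nonpos_of_nonneg hr'.le hs') ht'.le))
      · exact absurd hpos (not_lt.2 (mul_nonneg
          (mul_nonneg_of_nonpos_of_nonpos hr'.le hs'.le) ht'))
      · rw [abs_of_neg hr', abs_of_neg hs', abs_of_neg ht']; linarith
    have f₁ := mul_le_mul_of_nonneg_left hsum hac
    have f₂ : |r| * |s| * |t| ≤ a * c * b := by
      calc |r| * |s| * |t| ≤ a * a * b := by gcongr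
        _ ≤ a * c * b := by
          have := hab.trans hbc
          gcongr
    have f₃ := neg_abs_le (r * s * t)
    rw [eprod] at f₃
    linarith

theorem mul_le_det {a b c r s t : ℚ} (ha : 0 ≤ a) (hb : 0 ≤ b) (hc : 0 ≤ c)
    (hra : |r| ≤ a) (hrb : |r| ≤ b) (hsa : |s| ≤ a) (hsc : |s| ≤ c) (htb : |t| ≤ b)
    (htc : |t| ≤ c)
    (h : ∀ x y : ℚ, (x = a ∧ y = b) ∨ (x = a ∧ y = c) ∨ (x = b ∧ y = c) →
      0 ≤ x + y + r + s + t ∧ 0 ≤ x + y + r - s - t ∧ 0 ≤ x + y - r + s - t ∧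
        0 ≤ x + y - r - s + t) :
    2 * (a * b * c) ≤
      8 * (a * b * c) + 2 * (r * s * t) - 2 * (a * t ^ 2) - 2 * (b * s ^ 2) - 2 * (c * r ^ 2) := by
  obtain ⟨p₁, p₂, p₃, p₄⟩ := h a b (by simp)
  obtain ⟨q₁, q₂, q₃, q₄⟩ := h a c (by simp)
  obtain ⟨k₁, k₂, k₃, k₄⟩ := h b c (by simp)
  rcases le_total a b with hab | hab <;> rcases le_total b c with hbc | hbc <;>
    rcases le_total a c with hac | hac
  · exact mul_le_det_of_sorted ha hab hbc hra hsa htb p₁ p₂ p₃ p₄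
  · exact mul_le_det_of_sorted ha hab hbc hra hsa htb p₁ p₂ p₃ p₄
  · have := mul_le_det_of_sorted (r := s) (s := r) ha hac hbc hsa hra htc
      (by linarith) (by linarith) (by linarith) (by linarith)
    linarith
  · have := mul_le_det_of_sorted (r := s) (s := t) (t := r) hc hac hab hsc htc hra
      (by linarith) (by linarith) (by linarith) (by linarith)
    linarith
  · have := mul_le_det_of_sorted (r := r) (s := t) (t := s) hb hab hac hrb htb hsa
      (by linarith) (by linarith) (by linarith) (by linarith)
    linarith
  · have := mul_le_det_of_sorted (r := t) (s := r) (t := s) hb hbc hac htb hrb hsc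
      (by linarith) (by linarith) (by linarith) (by linarith)
    linarith
  · have := mul_le_det_of_sorted (r := t) (s := s) (t := r) hc hbc hab htc hsc hrb
      (by linarith) (by linarith) (by linarith) (by linarith)
    linarith
  · have := mul_le_det_of_sorted (r := t) (s := s) (t := r) hc hbc hab htc hsc hrb
      (by linarith) (by linarith) (by linarith) (by linarith)
    linarith

end Reduction

/-! ### Finiteness of the number of spinor genera -/

section Finiteness

variable {V : Type*} [AddCommGroup V] [Module ℚ V]

theorem span_range_update_add {ι E : Type*} [DecidableEq ι] [AddCommGroup E] (v : ι → E) (k : ι)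
    {w : E} (hw : w ∈ Submodule.span ℤ (v '' {k}ᶜ)) :
    Submodule.span ℤ (Set.range (Function.update v k (v k + w))) =
      Submodule.span ℤ (Set.range v) := by
  have hsub : v '' {k}ᶜ ⊆ Set.range (Function.update v k (v k + w)) := by
    rintro _ ⟨i, hi, rfl⟩
    exact ⟨i, Function.update_of_ne hi _ _⟩
  apply le_antisymm
  · rw [Submodule.span_le]
    rintro _ ⟨i, rfl⟩
    by_cases hi : i = k
    · subst hi
      rw [Function.update_self]
      exact add_mem (Submodule.subset_span ⟨i, rfl⟩)
        (Submodule.span_mono (Set.image_subset_range _ _) hw)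
    · rw [Function.update_of_ne hi]
      exact Submodule.subset_span ⟨i, rfl⟩
  · rw [Submodule.span_le]
    rintro _ ⟨i, rfl⟩
    by_cases hi : i = k
    · subst hi
      have h₁ : v i + w ∈ Submodule.span ℤ (Set.range (Function.update v i (v i + w))) :=
        Submodule.subset_span ⟨i, Function.update_self _ _ _⟩
      simpa using sub_mem h₁ (Submodule.span_mono hsub hw)
    · exact Submodule.subset_span (hsub ⟨i, hi, rfl⟩)

/-- A lattice on which `Q` is integral has a basis whose vectors cannot be shortened by adding
integral combinations of the other ones. -/
theorem exists_reduced_basis {d : ℕ} (hd : Module.finrank ℚ V = d) {Q : QuadraticForm ℚ V}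
    (hQ : Q.PosDef) {L : Submodule ℤ V} (hL : L.IsLattice ℚ)
    (hint : ∀ x ∈ L, ∃ k : ℤ, Q x = k) :
    ∃ b : Module.Basis (Fin d) ℚ V, L = Submodule.span ℤ (Set.range b) ∧
      ∀ k, ∀ w ∈ Submodule.span ℤ (b '' {k}ᶜ), Q (b k) ≤ Q (b k + w) := by
  classical
  let S := {b : Module.Basis (Fin d) ℚ V // L = Submodule.span ℤ (Set.range b)}
  have hS : Nonempty S := by
    obtain ⟨b, hb⟩ := exists_basis_span hd hL
    exact ⟨⟨b, hb⟩⟩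
  -- The sum is a natural number by integrality and positivity, so the floor loses nothing and a
  -- minimizing basis exists.
  let f : S → ℕ := fun b => ⌊∑ i, Q (b.1 i)⌋₊
  have hf (b : S) : (f b : ℚ) = ∑ i, Q (b.1 i) := by
    have h (i) : ∃ k : ℕ, Q (b.1 i) = k := by
      obtain ⟨k, hk⟩ := hint (b.1 i) (b.2.ge (Submodule.subset_span ⟨i, rfl⟩))
      have h0 : 0 ≤ Q (b.1 i) := hQ.nonneg _
      rw [hk] at h0
      lift k to ℕ using by exact_mod_cast h0
      exact ⟨k, by exact_mod_cast hk⟩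
    choose k hk using h
    have : ∑ i, Q (b.1 i) = ((∑ i, k i : ℕ) : ℚ) := by
      push_cast
      exact Finset.sum_congr rfl fun i _ => hk i
    simp only [f, this, Nat.floor_natCast]
  have hmin := fun b => Function.argmin_le f b
  set b := Function.argmin f with hb
  refine ⟨b.1, b.2, fun k w hw => ?_⟩
  have hspan := (span_range_update_add b.1 k hw).trans b.2.symm
  have htop : ⊤ ≤ Submodule.span ℚ (Set.range (Function.update b.1 k (b.1 k + w))) := by
    rw [← Submodule.span_span_of_tower ℤ, hspan, hL.span_eq_top]
  let b' := basisOfTopLeSpanOfCardEqFinrank _ htop (by rw [Fintype.card_fin, hd])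
  have hb' : ⇑b' = Function.update b.1 k (b.1 k + w) :=
    coe_basisOfTopLeSpanOfCardEqFinrank _ _ _
  have hle : (f b : ℚ) ≤ f ⟨b', by rw [hb', hspan]⟩ := Nat.cast_le.2 (hmin _)
  rw [hf, hf] at hle
  simp only [hb'] at hle
  rw [← Finset.add_sum_erase _ _ (Finset.mem_univ k),
    ← Finset.add_sum_erase Finset.univ (fun i => Q (Function.update b.1 k (b.1 k + w) i))
      (Finset.mem_univ k), Function.update_self] at hle
  have : ∑ i ∈ Finset.univ.erase k, Q (Function.update b.1 k (b.1 k + w) i) =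
      ∑ i ∈ Finset.univ.erase k, Q (b.1 i) :=
    Finset.sum_congr rfl fun i hi => by rw [Function.update_of_ne (Finset.ne_of_mem_erase hi)]
  rw [this] at hle
  linarith

/-- For a reduced basis, twice the product of the three values `Q (b i)` is at most the Gram
determinant. Each value is at least `1`, so the determinant bounds each `2 Q (b i)`, and these bound
the polar entries. -/
theorem exists_basis_abs_polar_le (hd : Module.finrank ℚ V = 3) {Q : QuadraticForm ℚ V}
    (hQ : Q.PosDef) {L : Submodule ℤ V} (hL : L.IsLattice ℚ)
    (hint : ∀ x ∈ L, ∃ k : ℤ, Q x = k) :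
    ∃ b : Module.Basis (Fin 3) ℚ V, L = Submodule.span ℤ (Set.range b) ∧
      ∀ i j, |QuadraticMap.polar Q (b i) (b j)| ≤ |gramDet Q b| := by
  obtain ⟨b, hbL, hb⟩ := exists_reduced_basis hd hQ hL hint
  refine ⟨b, hbL, ?_⟩
  have hself (i) : QuadraticMap.polar Q (b i) (b i) = 2 * Q (b i) := by
    rw [QuadraticMap.polar_self, two_nsmul, two_mul]
  have hpos (i) : 1 ≤ Q (b i) := by
    obtain ⟨k, hk⟩ := hint (b i) (hbL ▸ Submodule.subset_span ⟨i, rfl⟩)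
    have := hQ (b i) (b.ne_zero i)
    rw [hk] at this ⊢
    exact_mod_cast this
  have hmem (k i : Fin 3) (hik : i ≠ k) : b i ∈ Submodule.span ℤ (b '' {k}ᶜ) :=
    Submodule.subset_span ⟨i, hik, rfl⟩
  have hpair (i j) (hij : i ≠ j) : |QuadraticMap.polar Q (b i) (b j)| ≤ Q (b j) := by
    have h₁ := hb i _ (hmem i j hij.symm)
    have h₂ := hb i _ (neg_mem (hmem i j hij.symm))
    rw [QuadraticMap.map_add Q] at h₁ h₂
    rw [QuadraticMap.map_neg, QuadraticMap.polar_neg_right] at h₂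
    rw [abs_le]
    constructor <;> linarith
  have hpair' (i j) (hij : i ≠ j) : |QuadraticMap.polar Q (b i) (b j)| ≤ Q (b i) := by
    rw [QuadraticMap.polar_comm]
    exact hpair j i hij.symm
  -- These compare `b k` with `b k ± b i ± b j`, the four sign choices.
  have htriple (k i j) (hik : i ≠ k) (hjk : j ≠ k) :
      0 ≤ Q (b i) + Q (b j) + QuadraticMap.polar Q (b k) (b i) + QuadraticMap.polar Q (b k) (b j)
        + QuadraticMap.polar Q (b i) (b j) ∧
      0 ≤ Q (b i) + Q (b j) + QuadraticMap.polar Q (b k) (b i) - QuadraticMap.polar Q (b k) (b j)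
        - QuadraticMap.polar Q (b i) (b j) ∧
      0 ≤ Q (b i) + Q (b j) - QuadraticMap.polar Q (b k) (b i) + QuadraticMap.polar Q (b k) (b j)
        - QuadraticMap.polar Q (b i) (b j) ∧
      0 ≤ Q (b i) + Q (b j) - QuadraticMap.polar Q (b k) (b i) - QuadraticMap.polar Q (b k) (b j)
        + QuadraticMap.polar Q (b i) (b j) := by
    have hi := hmem k i hik
    have hj := hmem k j hjk
    have h₁ := hb k _ (add_mem hi hj)
    have h₂ := hb k _ (add_mem hi (neg_mem hj))
    have h₃ := hb k _ (add_mem (neg_mem hi) hj)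
    have h₄ := hb k _ (add_mem (neg_mem hi) (neg_mem hj))
    simp only [QuadraticMap.map_add Q, QuadraticMap.map_neg, QuadraticMap.polar_neg_right,
      QuadraticMap.polar_neg_left, QuadraticMap.polar_add_right] at h₁ h₂ h₃ h₄
    refine ⟨?_, ?_, ?_, ?_⟩ <;> linarith
  set a := Q (b 0)
  set β := Q (b 1)
  set c := Q (b 2)
  set r := QuadraticMap.polar Q (b 0) (b 1) with hr
  set s := QuadraticMap.polar Q (b 0) (b 2) with hs
  set t := QuadraticMap.polar Q (b 1) (b 2) with ht
  have hr' : QuadraticMap.polar Q (b 1) (b 0) = r := QuadraticMap.polar_comm _ _ _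
  have hs' : QuadraticMap.polar Q (b 2) (b 0) = s := QuadraticMap.polar_comm _ _ _
  have ht' : QuadraticMap.polar Q (b 2) (b 1) = t := QuadraticMap.polar_comm _ _ _
  have hdet : gramDet Q b = 8 * (a * β * c) + 2 * (r * s * t) - 2 * (a * t ^ 2) -
      2 * (β * s ^ 2) - 2 * (c * r ^ 2) := by
    rw [gramDet, Matrix.det_fin_three]
    simp only [LinearMap.BilinForm.toMatrix_apply, QuadraticMap.polarBilin_apply_apply, hself,
      hr', hs', ht', ← hr, ← hs, ← ht]
    ring
  have ha : 1 ≤ a := hpos 0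
  have hβ : 1 ≤ β := hpos 1
  have hc : 1 ≤ c := hpos 2
  have k₀ := htriple 0 1 2 (by decide) (by decide)
  have k₁ := htriple 1 0 2 (by decide) (by decide)
  have k₂ := htriple 2 0 1 (by decide) (by decide)
  rw [hr'] at k₁
  rw [hs', ht'] at k₂
  have hD := mul_le_det (r := r) (s := s) (t := t) (by linarith) (by linarith) (by linarith)
    (hpair' 0 1 (by decide)) (hpair 0 1 (by decide)) (hpair' 0 2 (by decide))
    (hpair 0 2 (by decide)) (hpair' 1 2 (by decide)) (hpair 1 2 (by decide)) (by
      rintro x y (⟨rfl, rfl⟩ | ⟨rfl, rfl⟩ | ⟨rfl, rfl⟩) <;> refine ⟨?_, ?_, ?_, ?_⟩ <;> linarith)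
  rw [← hdet] at hD
  have hD' := hD.trans (le_abs_self _)
  have haβ : a ≤ a * β := le_mul_of_one_le_right (by linarith) hβ
  have hβa : β ≤ a * β := le_mul_of_one_le_left (by linarith) ha
  have h1 : a * β ≤ a * β * c := le_mul_of_one_le_right (by linarith) hc
  have h2 : c ≤ a * β * c := le_mul_of_one_le_left (by linarith) (by linarith)
  have hle (i) : 2 * Q (b i) ≤ |gramDet Q b| := by
    fin_cases i
    · change 2 * a ≤ _; linarith
    · change 2 * β ≤ _; linarith
    · change 2 * c ≤ _; linarith
  intro i j
  by_cases hij : i = j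
  · subst hij
    rw [hself, abs_of_nonneg (by linarith [hpos i])]
    exact hle i
  · refine (hpair i j hij).trans ?_
    linarith [hle j, hpos j]

theorem exists_isometry_of_polar_eq {d : ℕ} {Q : QuadraticForm ℚ V}
    (b b' : Module.Basis (Fin d) ℚ V)
    (h : ∀ i j, QuadraticMap.polar Q (b' i) (b' j) = QuadraticMap.polar Q (b i) (b j)) :
    ∃ s ∈ isometryGroup Q, latticeMap s (Submodule.span ℤ (Set.range b)) =
      Submodule.span ℤ (Set.range b') := by
  set t := b.equiv b' (Equiv.refl _) with ht
  have htb (i) : t (b i) = b' i := by simp [ht]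
  refine ⟨t, fun x => ?_, ?_⟩
  · have hB : LinearMap.BilinForm.comp Q.polarBilin t.toLinearMap t.toLinearMap = Q.polarBilin :=
      LinearMap.BilinForm.ext_basis b fun i j => by simp [htb, h]
    have := congrArg (fun B => B x x) hB
    simpa [QuadraticMap.polar_self] using this
  · rw [latticeMap, Submodule.map_span, ← Set.range_comp]
    congr 2
    ext i
    exact htb i

/-- A genus of ternary lattices contains only finitely many spinor genera. -/
theorem finite_spinorGenera (hd : Module.finrank ℚ V = 3) {Q : QuadraticForm ℚ V}
    (hQ : Q.PosDef) {L : Submodule ℤ V} (hL : IsIntegralLattice Q L) :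
    (spinorGenera Q L).Finite := by
  obtain ⟨b₀, hb₀⟩ := exists_basis_span hd hL.isLattice
  have key (x : spinorGenera Q L) : ∃ (L' : Submodule ℤ V) (b : Module.Basis (Fin 3) ℚ V)
      (g : Fin 3 → Fin 3 → ℤ), L'.IsLattice ℚ ∧ spn Q L' = x.1 ∧
      L' = Submodule.span ℤ (Set.range b) ∧
      (∀ i j, QuadraticMap.polar Q (b i) (b j) = g i j) ∧ ∀ i j, |(g i j : ℚ)| ≤ |gramDet Q b₀| := by
    obtain ⟨x, L', hL', rfl⟩ := x
    have hint := integral_of_mem_gen hL.integral hL'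
    obtain ⟨b, hb, hle⟩ := exists_basis_abs_polar_le hd hQ hL'.1 hint
    have hpolar (i j) : ∃ k : ℤ, QuadraticMap.polar Q (b i) (b j) = k := by
      have hi : b i ∈ L' := hb ▸ Submodule.subset_span ⟨i, rfl⟩
      have hj : b j ∈ L' := hb ▸ Submodule.subset_span ⟨j, rfl⟩
      obtain ⟨k₁, h₁⟩ := hint _ (add_mem hi hj)
      obtain ⟨k₂, h₂⟩ := hint _ hi
      obtain ⟨k₃, h₃⟩ := hint _ hj
      exact ⟨k₁ - k₂ - k₃, by rw [QuadraticMap.polar, h₁, h₂, h₃]; push_cast; rfl⟩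
    choose g hg using hpolar
    refine ⟨L', b, g, hL'.1, rfl, hb, hg, fun i j => ?_⟩
    rw [← hg, ← abs_gramDet_eq_of_mem_gen b₀ b (by rw [← hb, ← hb₀]; exact hL')]
    exact hle i j
  choose L' b g hlat hspn hspan hg hbound using key
  -- Equal Gram matrices give a global isometry between the lattices, so their spinor genera
  -- coincide.
  have hinj : Function.Injective g := by
    intro x y hxy
    obtain ⟨s, hs, h⟩ := exists_isometry_of_polar_eq (Q := Q) (b x) (b y)
      (fun i j => by rw [hg, hg, hxy])
    rw [← hspan, ← hspan] at h
    have := spn_eq_of_mem (hlat x) (h ▸ latticeMap_mem_spn (hlat x) hs)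
    exact Subtype.ext (by rw [← hspn, ← hspn, this])
  set m : ℤ := ⌊|gramDet Q b₀|⌋
  have hrange : Set.range g ⊆ Set.Icc (fun _ _ => -m) (fun _ _ => m) := by
    rintro _ ⟨x, rfl⟩
    have h (i j) : |g x i j| ≤ m := Int.le_floor.2 (by
      rw [Int.cast_abs]; exact hbound x i j)
    exact ⟨fun i j => (abs_le.1 (h i j)).1, fun i j => (abs_le.1 (h i j)).2⟩
  have := ((Set.finite_Icc _ _).subset hrange).to_subtype
  exact Set.finite_coe_iff.1 (Finite.of_injective_finite_range hinj)

end Finiteness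

/-! ### Transport along the similarity and the action on the graph -/

section Transport

variable {V W : Type*} [AddCommGroup V] [Module ℚ V] [AddCommGroup W] [Module ℚ W]

/-- Transport of linear automorphisms of `V_p` to `W_p` along a linear equivalence `V ≃ W`. -/
def localConj (e : V ≃ₗ[ℚ] W) (p : ℕ) [Fact p.Prime]
    (σ : (ℚ_[p] ⊗[ℚ] V) ≃ₗ[ℚ_[p]] (ℚ_[p] ⊗[ℚ] V)) :
    (ℚ_[p] ⊗[ℚ] W) ≃ₗ[ℚ_[p]] (ℚ_[p] ⊗[ℚ] W) :=
  (LinearEquiv.baseChange ℚ ℚ_[p] V W e).symm.trans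
    (σ.trans (LinearEquiv.baseChange ℚ ℚ_[p] V W e))

theorem localConj_apply (e : V ≃ₗ[ℚ] W) (p : ℕ) [Fact p.Prime]
    (σ : (ℚ_[p] ⊗[ℚ] V) ≃ₗ[ℚ_[p]] (ℚ_[p] ⊗[ℚ] V)) (x : ℚ_[p] ⊗[ℚ] V) :
    localConj e p σ (LinearEquiv.baseChange ℚ ℚ_[p] V W e x) =
      LinearEquiv.baseChange ℚ ℚ_[p] V W e (σ x) := by
  simp only [localConj, LinearEquiv.trans_apply, LinearEquiv.symm_apply_apply]

theorem localConj_one (e : V ≃ₗ[ℚ] W) (p : ℕ) [Fact p.Prime] : localConj e p 1 = 1 := by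
  apply LinearEquiv.ext
  intro y
  obtain ⟨x, rfl⟩ := (LinearEquiv.baseChange ℚ ℚ_[p] V W e).surjective y
  exact localConj_apply e p 1 x

theorem localConj_localConj_symm (e : V ≃ₗ[ℚ] W) (p : ℕ) [Fact p.Prime]
    (σ : (ℚ_[p] ⊗[ℚ] W) ≃ₗ[ℚ_[p]] (ℚ_[p] ⊗[ℚ] W)) :
    localConj e p (localConj e.symm p σ) = σ := by
  have hs : LinearEquiv.baseChange ℚ ℚ_[p] W V e.symm =
    (LinearEquiv.baseChange ℚ ℚ_[p] V W e).symm := rfl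
  apply LinearEquiv.ext
  intro y
  simp only [localConj, hs, LinearEquiv.trans_apply, LinearEquiv.symm_symm,
    LinearEquiv.apply_symm_apply]

/-- The similarity factor `c` enters both sides equally, so conjugation by a similarity preserves
isometries. -/
theorem localConj_mem (e : V ≃ₗ[ℚ] W) (p : ℕ) [Fact p.Prime] {Q : QuadraticForm ℚ V}
    {R : QuadraticForm ℚ W} {c : ℚ} (h : ∀ x, R (e x) = c * Q x)
    {σ : (ℚ_[p] ⊗[ℚ] V) ≃ₗ[ℚ_[p]] (ℚ_[p] ⊗[ℚ] V)} (hσ : σ ∈ isometryGroup (localForm p Q)) :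
    localConj e p σ ∈ isometryGroup (localForm p R) := by
  intro y
  obtain ⟨x, rfl⟩ := (LinearEquiv.baseChange ℚ ℚ_[p] V W e).surjective y
  rw [localConj_apply, localForm_baseChange_apply p h, localForm_baseChange_apply p h, hσ]

theorem IsLocalImage.localConj (e : V ≃ₗ[ℚ] W)
    {σ : ∀ p : Nat.Primes, (ℚ_[p] ⊗[ℚ] V) ≃ₗ[ℚ_[p]] (ℚ_[p] ⊗[ℚ] V)} {L L' : Submodule ℤ V}
    (h : IsLocalImage σ L L') :
    IsLocalImage (fun p => localConj e p (σ p)) (latticeMap e L) (latticeMap e L') := by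
  intro p
  rw [localization_latticeMap, localization_latticeMap, h p, localImage, localImage,
    ← Submodule.map_comp, ← Submodule.map_comp]
  congr 1
  apply LinearMap.ext
  intro x
  exact (localConj_apply e p (σ p) x).symm

/-- Positive definiteness forces a representation to be injective, and the dimensions agree. -/
theorem exists_linearEquiv_eq {R : QuadraticForm ℚ W} {Q : QuadraticForm ℚ V} (hQ : Q.PosDef)
    [FiniteDimensional ℚ V] [FiniteDimensional ℚ W]
    (hVW : Module.finrank ℚ V = Module.finrank ℚ W) {n : ℕ} (hn : 0 < n)
    (φ : ((n : ℚ) • Q) →qᵢ R) : ∃ e : V ≃ₗ[ℚ] W, (∀ x, R (e x) = n * Q x) ∧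
      ∀ M, scaledImage φ M = latticeMap e M := by
  have hφ (x : V) : R (φ.toLinearMap x) = n * Q x := φ.map_app' x
  have hinj : Function.Injective φ.toLinearMap := by
    rw [injective_iff_map_eq_zero]
    intro x hx
    by_contra hx0
    have h := hφ x
    rw [hx, QuadraticMap.map_zero] at h
    exact (mul_pos (Nat.cast_pos.2 hn) (hQ x hx0)).ne h
  exact ⟨LinearMap.linearEquivOfInjective _ hinj hVW, hφ, fun M => rfl⟩

/-- Once an identification `e : V^n ≃ W` is fixed, representations are inclusions up to an
isometry of `W`. -/
theorem represents_iff {R : QuadraticForm ℚ W} {Q : QuadraticForm ℚ V} (hQ : Q.PosDef)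
    [FiniteDimensional ℚ V] [FiniteDimensional ℚ W] {n : ℕ} (hn : 0 < n) (e : V ≃ₗ[ℚ] W)
    (he : ∀ x, R (e x) = n * Q x) {N : Submodule ℤ W} {M : Submodule ℤ V} :
    Represents n R Q N M ↔ ∃ s ∈ isometryGroup R, latticeMap s (latticeMap e M) ≤ N := by
  constructor
  · rintro ⟨φ, hφ⟩
    obtain ⟨e', he', hM⟩ := exists_linearEquiv_eq hQ e.finrank_eq hn φ
    -- Two similarities with the same factor `n` differ by an isometry of `W`.
    refine ⟨e.symm.trans e', fun y => ?_, ?_⟩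
    · rw [LinearEquiv.trans_apply, he', ← he, LinearEquiv.apply_symm_apply]
    · rw [hM] at hφ
      rintro _ ⟨_, ⟨x, hx, rfl⟩, rfl⟩
      refine hφ ⟨x, hx, ?_⟩
      simp
  · rintro ⟨s, hs, h⟩
    refine ⟨⟨(e.trans s).toLinearMap, fun x => (hs (e x)).trans (he x)⟩, ?_⟩
    rintro _ ⟨x, hx, rfl⟩
    exact h ⟨e x, ⟨x, hx, rfl⟩, rfl⟩

/-- A family of local isometries permutes the spinor genera in a genus. -/
theorem exists_spinorGenera_map [FiniteDimensional ℚ V] {Q : QuadraticForm ℚ V} (hQ : Q.PosDef)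
    {L : Submodule ℤ V}
    {σ : ∀ p : Nat.Primes, (ℚ_[p] ⊗[ℚ] V) ≃ₗ[ℚ_[p]] (ℚ_[p] ⊗[ℚ] V)}
    (hσ : ∀ p : Nat.Primes, σ p ∈ isometryGroup (localForm p Q)) (hfin : {p | σ p ≠ 1}.Finite) :
    ∃ g : spinorGenera Q L → spinorGenera Q L, Function.Injective g ∧
      ∀ (y : spinorGenera Q L) (K K' : Submodule ℤ V), K ∈ y.1 → K'.IsLattice ℚ →
        IsLocalImage σ K K' → K' ∈ (g y).1 ∧ spn Q K' = (g y).1 := by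
  have key (y : spinorGenera Q L) : ∃ K K' : Submodule ℤ V, K ∈ gen Q L ∧ spn Q K = y.1 ∧
      K'.IsLattice ℚ ∧ IsLocalImage σ K K' := by
    obtain ⟨y, K, hK, rfl⟩ := y
    obtain ⟨K', hK', h⟩ := exists_isLocalImage hK.1 hfin
    exact ⟨K, K', hK, rfl, hK', h⟩
  choose K K' hK hy hK' hKK using key
  refine ⟨fun y => ⟨spn Q (K' y), K' y,
    mem_gen_trans (hK y) (mem_gen_of_isLocalImage (hK' y) hσ (hKK y)), rfl⟩, ?_, ?_⟩
  -- Injectivity comes from applying the inverse family to the image lattices.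
  · intro x y hxy
    have h₁ : K' y ∈ spn Q (K' x) := by
      have h₀ : spn Q (K' x) = spn Q (K' y) := congrArg Subtype.val hxy
      rw [h₀]
      exact mem_spn_self Q (hK' y)
    have h₂ := mem_spn_of_isLocalImage hQ (fun p => inv_mem (hσ p)) (hK y).1 h₁ (hKK x).inv
      (hKK y).inv
    have h₃ := spn_eq_of_mem (hK x).1 h₂
    rw [hy, hy] at h₃
    exact Subtype.ext h₃.symm
  · intro y M M' hM hM' h
    rw [← hy] at hM
    have := mem_spn_of_isLocalImage hQ hσ hM' hM (hKK y) h
    exact ⟨this, spn_eq_of_mem (hK' y) this⟩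

/-- A compatible pair of families of local isometries acts on the graph. -/
theorem exists_spinorGraph_map [FiniteDimensional ℚ V] [FiniteDimensional ℚ W]
    {R : QuadraticForm ℚ W} {Q : QuadraticForm ℚ V} (hR : R.PosDef) (hQ : Q.PosDef) {n : ℕ}
    (hn : 0 < n) (e : V ≃ₗ[ℚ] W) (he : ∀ x, R (e x) = n * Q x) (N : Submodule ℤ W)
    (M : Submodule ℤ V) {σ : ∀ p : Nat.Primes, (ℚ_[p] ⊗[ℚ] V) ≃ₗ[ℚ_[p]] (ℚ_[p] ⊗[ℚ] V)}
    (hσ : ∀ p : Nat.Primes, σ p ∈ isometryGroup (localForm p Q)) (hfin : {p | σ p ≠ 1}.Finite) :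
    ∃ (f : spinorGenera R N → spinorGenera R N) (g : spinorGenera Q M → spinorGenera Q M),
      Function.Injective f ∧ Function.Injective g ∧
      (∀ (x : spinorGenera R N) (K K' : Submodule ℤ W), K ∈ x.1 → K'.IsLattice ℚ →
        IsLocalImage (fun p => localConj e p (σ p)) K K' → spn R K' = (f x).1) ∧
      (∀ (y : spinorGenera Q M) (K K' : Submodule ℤ V), K ∈ y.1 → K'.IsLattice ℚ →
        IsLocalImage σ K K' → spn Q K' = (g y).1) ∧
      ∀ x y, (∃ N' ∈ x.1, ∃ M' ∈ y.1, Represents n R Q N' M') →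
        ∃ N' ∈ (f x).1, ∃ M' ∈ (g y).1, Represents n R Q N' M' := by
  have hσ' (p : Nat.Primes) : localConj e p (σ p) ∈ isometryGroup (localForm p R) :=
    localConj_mem e p he (hσ p)
  have hfin' : {p : Nat.Primes | localConj e p (σ p) ≠ 1}.Finite :=
    hfin.subset fun p hp h => hp (by rw [h, localConj_one])
  obtain ⟨f, hf, hf'⟩ := exists_spinorGenera_map hR (L := N) hσ' hfin'
  obtain ⟨g, hg, hg'⟩ := exists_spinorGenera_map hQ (L := M) hσ hfin
  refine ⟨f, g, hf, hg, fun x K K' h h' h'' => (hf' x K K' h h' h'').2,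
    fun y K K' h h' h'' => (hg' y K K' h h' h'').2, ?_⟩
  rintro x y ⟨N', hN', M', hM', h⟩
  obtain ⟨s, hs, hle⟩ := (represents_iff hQ hn e he).1 h
  -- Replacing `N'` by `s⁻¹ N'` stays in the same spinor genus and turns the representation into an
  -- inclusion, which can be moved prime by prime.
  have hN'x : latticeMap s⁻¹ N' ∈ x.1 := by
    obtain ⟨x, K, hK, rfl⟩ := x
    exact mem_spn_trans hN' (latticeMap_mem_spn hN'.1 (inv_mem hs))
  have hlatN : (latticeMap s⁻¹ N').IsLattice ℚ := by
    obtain ⟨x, K, hK, rfl⟩ := x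
    exact hN'x.1
  have hlatM : M'.IsLattice ℚ := by
    obtain ⟨y, K, hK, rfl⟩ := y
    exact hM'.1
  have hle' : latticeMap e M' ≤ latticeMap s⁻¹ N' := by
    have h₁ : latticeMap s⁻¹ (latticeMap s (latticeMap e M')) ≤ latticeMap s⁻¹ N' :=
      Submodule.map_mono hle
    have h₂ : latticeMap s⁻¹ (latticeMap s (latticeMap e M')) = latticeMap e M' :=
      latticeMap_symm_latticeMap s _
    rwa [h₂] at h₁
  obtain ⟨M'', hM'', hloc⟩ := exists_isLocalImage hlatM hfin
  obtain ⟨N'', hN'', hloc'⟩ := exists_isLocalImage hlatN hfin'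
  refine ⟨N'', (hf' x _ _ hN'x hN'' hloc').1, M'', (hg' y _ _ hM' hM'' hloc).1,
    (represents_iff hQ hn e he).2 ⟨1, one_mem _, ?_⟩⟩
  have h₃ := (hloc.localConj e).le hloc' hN'' hle'
  rintro _ ⟨z, hz, rfl⟩
  exact h₃ hz

end Transport

/-! ### Biregularity by double counting -/

section Graph

theorem encard_neighborSet_le {A B : Type*} {G : SimpleGraph (A ⊕ B)} {f : A → A} {g : B → B}
    (hf : Function.Injective f) (hg : Function.Injective g)
    (h : ∀ x y, G.Adj x y → G.Adj (Sum.map f g x) (Sum.map f g y)) (x : A ⊕ B) :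
    (G.neighborSet x).encard ≤ (G.neighborSet (Sum.map f g x)).encard :=
  Set.encard_le_encard_of_injOn (f := Sum.map f g) (fun y hy => h x y hy)
    (hf.sumMap hg).injOn

theorem exists_isBiregular {A B : Type*} [Finite A] [Finite B] {G : SimpleGraph (A ⊕ B)}
    (hA : ∀ a a', ¬G.Adj (.inl a) (.inl a')) (hB : ∀ b b', ¬G.Adj (.inr b) (.inr b'))
    (hA' : ∀ a a', (G.neighborSet (.inl a)).encard ≤ (G.neighborSet (.inl a')).encard)
    (hB' : ∀ b b', (G.neighborSet (.inr b)).encard ≤ (G.neighborSet (.inr b')).encard)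
    {a₀ : A} {b₀ : B} (h₀ : G.Adj (.inl a₀) (.inr b₀)) :
    ∃ u v : ℕ, 0 < u ∧ 0 < v ∧ u * Nat.card A = v * Nat.card B ∧ IsBiregular G u v := by
  classical
  have := Fintype.ofFinite A
  have := Fintype.ofFinite B
  let r : A → B → Prop := fun a b => G.Adj (.inl a) (.inr b)
  have eA (a : A) : (G.neighborSet (.inl a)).encard =
      (Finset.univ.bipartiteAbove r a).card := by
    have : G.neighborSet (.inl a) = Sum.inr '' (Finset.univ.bipartiteAbove r a : Set B) := by
      ext (y | y)
      · simpa using hA a y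
      · simp [r]
    rw [this, Sum.inr_injective.encard_image, Set.encard_coe_eq_coe_finsetCard]
  have eB (b : B) : (G.neighborSet (.inr b)).encard =
      (Finset.univ.bipartiteBelow r b).card := by
    have : G.neighborSet (.inr b) = Sum.inl '' (Finset.univ.bipartiteBelow r b : Set A) := by
      ext (y | y)
      · simp [r, G.adj_comm]
      · simpa using hB b y
    rw [this, Sum.inl_injective.encard_image, Set.encard_coe_eq_coe_finsetCard]
  have regA (a : A) : (Finset.univ.bipartiteAbove r a).card =
      (Finset.univ.bipartiteAbove r a₀).card := by
    have := le_antisymm (hA' a a₀) (hA' a₀ a)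
    rw [eA, eA] at this
    exact_mod_cast this
  have regB (b : B) : (Finset.univ.bipartiteBelow r b).card =
      (Finset.univ.bipartiteBelow r b₀).card := by
    have := le_antisymm (hB' b b₀) (hB' b₀ b)
    rw [eB, eB] at this
    exact_mod_cast this
  refine ⟨(Finset.univ.bipartiteAbove r a₀).card, (Finset.univ.bipartiteBelow r b₀).card,
    Finset.card_pos.2 ⟨b₀, by simpa [r] using h₀⟩, Finset.card_pos.2 ⟨a₀, by simpa [r] using h₀⟩,
    ?_, fun a => ?_, fun b => ?_⟩
  · have := Finset.card_mul_eq_card_mul r (s := Finset.univ) (t := Finset.univ)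
      (fun a _ => regA a) (fun b _ => regB b)
    rw [Nat.card_eq_fintype_card, Nat.card_eq_fintype_card, mul_comm, ← Finset.card_univ, this,
      Finset.card_univ, mul_comm]
  · rw [eA, regA]
  · rw [eB, regB]

end Graph

end QuadLattice

end

/-! ### Transitivity on both vertex classes and the theorem -/

open QuadLattice
theorem lemma4p3 {W V : Type*} [AddCommGroup W] [Module ℚ W] [AddCommGroup V] [Module ℚ V]
    (hW : Module.finrank ℚ W = 3) (hV : Module.finrank ℚ V = 3)
    (R : QuadraticForm ℚ W) (Q : QuadraticForm ℚ V) (hR : R.PosDef) (hQ : Q.PosDef)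
    (N : Submodule ℤ W) (M : Submodule ℤ V)
    (hN : IsIntegralLattice R N) (hM : IsIntegralLattice Q M)
    (n : ℕ) (hn : 0 < n) (hNM : IsRepresentablePair n R Q N M) :
    (spinorGenera R N).Finite ∧ (spinorGenera Q M).Finite ∧
    (∃ u v : ℕ, 0 < u ∧ 0 < v ∧
      u * numSpinorGenera R N = v * numSpinorGenera Q M ∧
      IsBiregular (spinorGraph n R Q N M) u v) ∧
    (numSpinorGenera R N = numSpinorGenera Q M →
      ∃ d : ℕ, 0 < d ∧ ∀ x, ((spinorGraph n R Q N M).neighborSet x).encard = d) := by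
  have : FiniteDimensional ℚ W := .of_finrank_pos (by omega)
  have : FiniteDimensional ℚ V := .of_finrank_pos (by omega)
  have finN := finite_spinorGenera hW hR hN
  have finM := finite_spinorGenera hV hQ hM
  obtain ⟨φ, hφ, -⟩ := hNM
  obtain ⟨e, he, -⟩ := exists_linearEquiv_eq hQ (hV.trans hW.symm) hn φ
  let a₀ : spinorGenera R N := ⟨spn R N, N, mem_gen_self R hN.isLattice, rfl⟩
  let b₀ : spinorGenera Q M := ⟨spn Q M, M, mem_gen_self Q hM.isLattice, rfl⟩
  have h₀ : (spinorGraph n R Q N M).Adj (.inl a₀) (.inr b₀) :=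
    ⟨N, mem_spn_self R hN.isLattice, M, mem_spn_self Q hM.isLattice, φ, hφ⟩
  have hadj {f : spinorGenera R N → spinorGenera R N} {g : spinorGenera Q M → spinorGenera Q M}
      (h : ∀ x y, (∃ N' ∈ x.1, ∃ M' ∈ y.1, Represents n R Q N' M') →
        ∃ N' ∈ (f x).1, ∃ M' ∈ (g y).1, Represents n R Q N' M')
      (x y) (hxy : (spinorGraph n R Q N M).Adj x y) :
      (spinorGraph n R Q N M).Adj (Sum.map f g x) (Sum.map f g y) := by
    rcases x with x | x <;> rcases y with y | y
    · exact hxy.elim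
    · exact h x y hxy
    · exact h y x hxy
    · exact hxy.elim
  -- A family carrying a lattice of `a` to one of `a'` embeds the neighbours of `a` into those of
  -- `a'`. Both orders of `a` and `a'` are covered, so the degrees are equal.
  have hA (a a') : ((spinorGraph n R Q N M).neighborSet (.inl a)).encard ≤
      ((spinorGraph n R Q N M).neighborSet (.inl a')).encard := by
    obtain ⟨a, N₁, hN₁, rfl⟩ := a
    obtain ⟨a', N₂, hN₂, rfl⟩ := a'
    obtain ⟨σ, hσ, hfin, hloc⟩ := exists_isLocalImage_of_mem_gen hN₁.1
      (mem_gen_trans (mem_gen_symm hN.isLattice hN₁) hN₂)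
    have he' (y : W) : Q (e.symm y) = (n : ℚ)⁻¹ * R y := by
      have h := he (e.symm y)
      rw [LinearEquiv.apply_symm_apply] at h
      rw [h, inv_mul_cancel_left₀ (Nat.cast_ne_zero.2 hn.ne')]
    -- The graph action takes a family on `V`, so the one on `W` is pulled back by `e⁻¹`, a
    -- similarity with factor `n⁻¹`.
    obtain ⟨f, g, hf, hg, hf', -, h⟩ := exists_spinorGraph_map hR hQ hn e he N M
      (σ := fun p => localConj e.symm p (σ p)) (fun p => localConj_mem e.symm p he' (hσ p))
      (hfin.subset fun p hp h => hp (by rw [h, localConj_one]))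
    have heq := hf' ⟨_, N₁, hN₁, rfl⟩ N₁ N₂ (mem_spn_self R hN₁.1) hN₂.1
      (by simpa only [localConj_localConj_symm] using hloc)
    have := encard_neighborSet_le hf hg (hadj h) (.inl ⟨_, N₁, hN₁, rfl⟩)
    convert this using 4
    exact congrArg Sum.inl (Subtype.ext heq)
  have hB (b b') : ((spinorGraph n R Q N M).neighborSet (.inr b)).encard ≤
      ((spinorGraph n R Q N M).neighborSet (.inr b')).encard := by
    obtain ⟨b, M₁, hM₁, rfl⟩ := b
    obtain ⟨b', M₂, hM₂, rfl⟩ := b'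
    obtain ⟨σ, hσ, hfin, hloc⟩ := exists_isLocalImage_of_mem_gen hM₁.1
      (mem_gen_trans (mem_gen_symm hM.isLattice hM₁) hM₂)
    obtain ⟨f, g, hf, hg, -, hg', h⟩ := exists_spinorGraph_map hR hQ hn e he N M hσ hfin
    have heq := hg' ⟨_, M₁, hM₁, rfl⟩ M₁ M₂ (mem_spn_self Q hM₁.1) hM₂.1 hloc
    have := encard_neighborSet_le hf hg (hadj h) (.inr ⟨_, M₁, hM₁, rfl⟩)
    convert this using 4
    exact congrArg Sum.inr (Subtype.ext heq)
  have := finN.to_subtype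
  have := finM.to_subtype
  obtain ⟨u, v, hu, hv, huv, hreg⟩ := exists_isBiregular (fun a a' h => h) (fun b b' h => h)
    hA hB h₀
  rw [Nat.card_coe_set_eq, Nat.card_coe_set_eq] at huv
  refine ⟨finN, finM, ⟨u, v, hu, hv, huv, hreg⟩, fun hg => ⟨u, hu, ?_⟩⟩
  -- With equal nonzero class sizes, `u g(N) = v g(M)` cancels to `u = v`.
  have hpos : 0 < numSpinorGenera Q M := (Set.ncard_pos finM).2 ⟨_, b₀.2⟩
  have huv' : u = v := Nat.eq_of_mul_eq_mul_right hpos 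
    ((congrArg (u * ·) hg.symm).trans huv)
  rintro (a | b)
  · exact hreg.1 a
  · rw [huv']
    exact hreg.2 b
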